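/- Let $k$ be a field of characteristic $0$. A linear algebra over $k$ is a $k$-vector space with a bilinear multiplication (not necessarily associative or unital); it is power-associative if, for every element $a$ and every $n\ge 1$, all bracketings of the power $a^n$ have the same value. Let $\Theta$ be the variety of all power-associative algebras over $k$, and let $\Theta^0$ be the category whose objects are the free algebras $F(X)$ of $\Theta$ generated by the finite subsets $X$ of a fixed countably infinite set of symbols, and whose morphisms are all homomorphisms of $k$-algebras. Let $\mathfrak A$ be the group of all automorphisms of the category $\Theta^0$ and $\mathfrak Y$ the normal subgroup of inner automorphisms, that is, those isomorphic as functors to the identity. Then $$\mathfrak A/\mathfrak Y\;\cong\; k^{*}\rtimes \mathrm{Aut}\,k ,$$ where $\mathrm{Aut}\,k$ is the group of field automorphisms of $k$, acting on $k^*$ in the natural way. Moreover, call an automorphism $\Phi$ of $\Theta^0$ strongly stable if it preserves all objects and there are bijections $s_F:F\to F$, one for each object $F=F(X)$, such that $s_F|_X=\mathrm{id}_X$ and $\Phi(\psi)=s_F\psi s_D^{-1}$ for every morphism $\psi:D\to F$. Then the strongly stable automorphisms are exactly those given by the systems of words $$w_\lambda(x)=\varphi(\lambda)x\ (\lambda\in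 k),\qquad w_+(x_1,x_2)=x_1+x_2,\qquad w_\cdot(x_1,x_2)=\alpha_{1,2}x_1x_2+\alpha_{2,1}x_2x_1$$ with $\varphi\in\mathrm{Aut}\,k$ and $\alpha_{1,2},\alpha_{2,1}\in k$, $\alpha_{1,2}\ne\pm\alpha_{2,1}$, where "given by" means that $s_F(\lambda f)=\varphi(\lambda)s_F(f)$, $s_F(f+g)=s_F(f)+s_F(g)$ and $s_F(fg)=\alpha_{1,2}s_F(f)s_F(g)+\alpha_{2,1}s_F(g)s_F(f)$ for all objects $F$, all $f,g\in F$ and all $\lambda\in k$: every strongly stable automorphism is given by exactly one such triple $(\varphi,\alpha_{1,2},\alpha_{2,1})$, and every such triple gives exactly one strongly stable automorphism. -/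

import Mathlib

open CategoryTheory

universe u

/-! ### Power-associative algebras

A linear algebra over a field `k` is a `k`-vector space with a bilinear multiplication, neither
associative nor unital in general. It is power-associative when all bracketings of every power
`a ^ n` agree. -/

/-- The identities `x (x x) = (x x) x`, `x (x (x x)) = x ((x x) x) = … = (x x) (x x)`, and so on:
any two bracketings `u`, `v` of the power `a ^ n` have the same value. -/
def IsPowerAssociative (A : Type*) [Mul A] : Prop :=
  ∀ (u v : FreeMagma Unit), u.length = v.length →
    ∀ a : A, FreeMagma.lift (fun _ => a) u = FreeMagma.lift (fun _ => a) v

/-! ### The free power-associative algebra -/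

noncomputable section

/-- The two-sided ideal of identities: the least ideal of the absolutely free algebra on `X`
that contains all the values of the power-associativity identities. -/
def powerAssocIdeal (k : Type u) [Field k] (X : Type) :
    Submodule k (FreeNonUnitalNonAssocAlgebra k X) :=
  sInf {I | (∀ (u v : FreeMagma Unit), u.length = v.length →
        ∀ a : FreeNonUnitalNonAssocAlgebra k X,
          FreeMagma.lift (fun _ => a) u - FreeMagma.lift (fun _ => a) v ∈ I) ∧
      ∀ a ∈ I, ∀ b : FreeNonUnitalNonAssocAlgebra k X, a * b ∈ I ∧ b * a ∈ I}

/-- The free power-associative `k`-algebra `F(X)` generated by `X`. -/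
def FreePowerAssoc (k : Type u) [Field k] (X : Type) : Type u :=
  FreeNonUnitalNonAssocAlgebra k X ⧸ powerAssocIdeal k X

namespace FreePowerAssoc

variable (k : Type u) [Field k] (X : Type)

theorem sub_mem_ideal (u v : FreeMagma Unit) (h : u.length = v.length)
    (a : FreeNonUnitalNonAssocAlgebra k X) :
    FreeMagma.lift (fun _ => a) u - FreeMagma.lift (fun _ => a) v ∈ powerAssocIdeal k X :=
  Submodule.mem_sInf.2 fun _ hI => hI.1 u v h a

theorem mul_mem_ideal {a : FreeNonUnitalNonAssocAlgebra k X} (ha : a ∈ powerAssocIdeal k X)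
    (b : FreeNonUnitalNonAssocAlgebra k X) :
    a * b ∈ powerAssocIdeal k X ∧ b * a ∈ powerAssocIdeal k X :=
  ⟨Submodule.mem_sInf.2 fun I hI => (hI.2 a (Submodule.mem_sInf.1 ha I hI) b).1,
    Submodule.mem_sInf.2 fun I hI => (hI.2 a (Submodule.mem_sInf.1 ha I hI) b).2⟩

instance : AddCommGroup (FreePowerAssoc k X) :=
  inferInstanceAs (AddCommGroup (FreeNonUnitalNonAssocAlgebra k X ⧸ powerAssocIdeal k X))

instance : Module k (FreePowerAssoc k X) :=
  inferInstanceAs (Module k (FreeNonUnitalNonAssocAlgebra k X ⧸ powerAssocIdeal k X))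

/-- The quotient map from the absolutely free algebra. -/
def mkL : FreeNonUnitalNonAssocAlgebra k X →ₗ[k] FreePowerAssoc k X :=
  (powerAssocIdeal k X).mkQ

theorem mkL_surjective : Function.Surjective (mkL k X) :=
  (powerAssocIdeal k X).mkQ_surjective

theorem mkL_eq_iff {a b : FreeNonUnitalNonAssocAlgebra k X} :
    mkL k X a = mkL k X b ↔ a - b ∈ powerAssocIdeal k X :=
  Submodule.Quotient.eq _

instance : Mul (FreePowerAssoc k X) where
  mul := Quotient.map₂ (· * ·) (by
    intro a a' ha b b' hb
    have ha' : a - a' ∈ powerAssocIdeal k X := (Submodule.quotientRel_def _).1 ha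
    have hb' : b - b' ∈ powerAssocIdeal k X := (Submodule.quotientRel_def _).1 hb
    refine (Submodule.quotientRel_def _).2 ?_
    have h : a * b - a' * b' = (a - a') * b + a' * (b - b') := by
      rw [sub_mul, mul_sub]; abel
    rw [h]
    exact Submodule.add_mem _ (mul_mem_ideal k X ha' b).1 (mul_mem_ideal k X hb' a').2)

theorem mkL_mul (a b : FreeNonUnitalNonAssocAlgebra k X) :
    mkL k X (a * b) = mkL k X a * mkL k X b := rfl

instance : NonUnitalNonAssocRing (FreePowerAssoc k X) where
  left_distrib a b c := by
    obtain ⟨a, rfl⟩ := mkL_surjective k X a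
    obtain ⟨b, rfl⟩ := mkL_surjective k X b
    obtain ⟨c, rfl⟩ := mkL_surjective k X c
    simp only [← mkL_mul, ← map_add, mul_add]
  right_distrib a b c := by
    obtain ⟨a, rfl⟩ := mkL_surjective k X a
    obtain ⟨b, rfl⟩ := mkL_surjective k X b
    obtain ⟨c, rfl⟩ := mkL_surjective k X c
    simp only [← mkL_mul, ← map_add, add_mul]
  zero_mul a := by
    obtain ⟨a, rfl⟩ := mkL_surjective k X a
    rw [← map_zero (mkL k X), ← mkL_mul, zero_mul]
  mul_zero a := by
    obtain ⟨a, rfl⟩ := mkL_surjective k X a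
    rw [← map_zero (mkL k X), ← mkL_mul, mul_zero]

instance : IsScalarTower k (FreePowerAssoc k X) (FreePowerAssoc k X) where
  smul_assoc t a b := by
    obtain ⟨a, rfl⟩ := mkL_surjective k X a
    obtain ⟨b, rfl⟩ := mkL_surjective k X b
    simp only [smul_eq_mul, ← map_smul, ← mkL_mul, smul_mul_assoc]

instance : SMulCommClass k (FreePowerAssoc k X) (FreePowerAssoc k X) where
  smul_comm t a b := by
    obtain ⟨a, rfl⟩ := mkL_surjective k X a
    obtain ⟨b, rfl⟩ := mkL_surjective k X b
    simp only [smul_eq_mul, ← map_smul, ← mkL_mul, mul_smul_comm]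

/-- The quotient map as a homomorphism of algebras. -/
def mk : FreeNonUnitalNonAssocAlgebra k X →ₙₐ[k] FreePowerAssoc k X :=
  { mkL k X with
    map_mul' := mkL_mul k X
    map_zero' := map_zero (mkL k X) }

theorem mk_surjective : Function.Surjective (mk k X) := mkL_surjective k X

variable {X}

/-- The free generators. -/
def of (x : X) : FreePowerAssoc k X := mk k X (FreeNonUnitalNonAssocAlgebra.of k x)

variable (X)

theorem map_lift {A B : Type*} [Mul A] [Mul B] (f : A →ₙ* B) (a : A) (w : FreeMagma Unit) :
    f (FreeMagma.lift (fun _ => a) w) = FreeMagma.lift (fun _ => f a) w := by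
  induction w with
  | ih1 x => simp
  | ih2 x y hx hy => simp [hx, hy]

/-- `F(X)` is power-associative. -/
theorem isPowerAssociative : IsPowerAssociative (FreePowerAssoc k X) := by
  intro u v h a
  obtain ⟨a, rfl⟩ := mk_surjective k X a
  have hu := map_lift (mk k X : FreeNonUnitalNonAssocAlgebra k X →ₙ* FreePowerAssoc k X) a u
  have hv := map_lift (mk k X : FreeNonUnitalNonAssocAlgebra k X →ₙ* FreePowerAssoc k X) a v
  refine hu.symm.trans (Eq.trans ?_ hv)
  exact (mkL_eq_iff k X).2 (sub_mem_ideal k X u v h a)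

/-- The universal property: a map from `X` to a power-associative algebra extends uniquely to a
homomorphism from `F(X)`. -/
theorem existsUnique_lift {A : Type*} [NonUnitalNonAssocRing A] [Module k A]
    [IsScalarTower k A A] [SMulCommClass k A A] (hA : IsPowerAssociative A) (f : X → A) :
    ∃! g : FreePowerAssoc k X →ₙₐ[k] A, ∀ x, g (of k x) = f x := by
  set F := FreeNonUnitalNonAssocAlgebra.lift k f with hF
  have hker : powerAssocIdeal k X ≤ LinearMap.ker (F : _ →ₗ[k] A) := by
    refine sInf_le ⟨fun u v h a => ?_, fun a ha b => ?_⟩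
    · have hu := map_lift (F : FreeNonUnitalNonAssocAlgebra k X →ₙ* A) a u
      have hv := map_lift (F : FreeNonUnitalNonAssocAlgebra k X →ₙ* A) a v
      have huv := hu.trans ((hA u v h _).trans hv.symm)
      have huv' : F (FreeMagma.lift (fun _ => a) u) = F (FreeMagma.lift (fun _ => a) v) := huv
      change F (_ - _) = 0
      rw [map_sub, huv', sub_self]
    · have ha' : F a = 0 := ha
      constructor
      · change F (a * b) = 0
        rw [map_mul, ha', zero_mul]
      · change F (b * a) = 0
        rw [map_mul, ha', mul_zero]
  let g : FreePowerAssoc k X →ₗ[k] A := (powerAssocIdeal k X).liftQ (F : _ →ₗ[k] A) hker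
  have hg : ∀ a, g (mkL k X a) = F a := fun a => rfl
  refine ⟨{ g with
    map_mul' := fun a b => ?_
    map_zero' := map_zero g }, fun x => ?_, fun g' hg' => ?_⟩
  · obtain ⟨a, rfl⟩ := mkL_surjective k X a
    obtain ⟨b, rfl⟩ := mkL_surjective k X b
    change g (mkL k X a * mkL k X b) = g (mkL k X a) * g (mkL k X b)
    rw [← mkL_mul, hg, hg, hg, map_mul]
  · exact (hg _).trans (FreeNonUnitalNonAssocAlgebra.lift_of_apply k f x)
  · have h1 : g'.comp (mk k X) = F := by
      apply FreeNonUnitalNonAssocAlgebra.hom_ext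
      intro x
      exact (hg' x).trans (FreeNonUnitalNonAssocAlgebra.lift_of_apply k f x).symm
    ext a
    obtain ⟨a, rfl⟩ := mkL_surjective k X a
    exact DFunLike.congr_fun h1 a

end FreePowerAssoc

/-! ### The category of finitely generated free power-associative algebras -/

/-- An object `F(X)` of the category: it is given by a finite subset `X` of the countable set
`{x₀, x₁, x₂, …}` of symbols, indexed by `ℕ`. -/
structure FreePACat (k : Type u) [Field k] : Type where
  /-- the finite set of free generators -/
  gens : Finset ℕ

namespace FreePACat

variable {k : Type u} [Field k]

/-- The algebra `F(X)`. -/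
abbrev Alg (X : FreePACat k) : Type u := FreePowerAssoc k X.gens

/-- Morphisms are all the homomorphisms of `k`-algebras. -/
@[ext]
structure Hom (X Y : FreePACat k) : Type u where
  /-- the homomorphism of algebras -/
  toAlgHom : X.Alg →ₙₐ[k] Y.Alg

instance : Category.{u} (FreePACat k) where
  Hom := Hom
  id X := ⟨NonUnitalAlgHom.id k X.Alg⟩
  comp f g := ⟨g.toAlgHom.comp f.toAlgHom⟩

end FreePACat

/-! ### The automorphism group and the inner automorphisms -/

/-- The group of all automorphisms of the category (invertible functors). -/
abbrev AutPACat (k : Type u) [Field k] : Type u := Aut (Cat.of (FreePACat k))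

namespace AutPACat

variable {k : Type u} [Field k]

/-- The underlying functor of an automorphism. -/
def functor (Φ : AutPACat k) : FreePACat k ⥤ FreePACat k := Φ.hom.toFunctor

theorem functor_one : functor (1 : AutPACat k) = 𝟭 (FreePACat k) := rfl

theorem functor_mul (Φ Ψ : AutPACat k) : functor (Φ * Ψ) = functor Ψ ⋙ functor Φ := rfl

/-- An automorphism is inner if it is isomorphic, as a functor, to the identity. -/
def IsInner (Φ : AutPACat k) : Prop := Nonempty (𝟭 (FreePACat k) ≅ functor Φ)

theorem IsInner.one : IsInner (1 : AutPACat k) := ⟨Iso.refl _⟩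

theorem IsInner.conj {Φ : AutPACat k} (h : IsInner Φ) (Ψ : AutPACat k) :
    IsInner (Ψ * Φ * Ψ⁻¹) := by
  obtain ⟨e⟩ := h
  have h1 : functor Ψ⁻¹ ⋙ 𝟭 _ ⋙ functor Ψ = 𝟭 (FreePACat k) := by
    rw [Functor.id_comp, ← functor_mul, mul_inv_cancel, functor_one]
  exact ⟨(eqToIso h1).symm ≪≫
    Functor.isoWhiskerLeft (functor Ψ⁻¹) (Functor.isoWhiskerRight e (functor Ψ))⟩

theorem IsInner.mul {Φ Ψ : AutPACat k} (h : IsInner Φ) (h' : IsInner Ψ) : IsInner (Φ * Ψ) := by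
  obtain ⟨e⟩ := h
  obtain ⟨e'⟩ := h'
  exact ⟨e' ≪≫ Functor.isoWhiskerLeft (functor Ψ) e⟩

theorem IsInner.inv {Φ : AutPACat k} (h : IsInner Φ) : IsInner Φ⁻¹ := by
  obtain ⟨e⟩ := h
  have h1 : functor Φ⁻¹ ⋙ functor Φ = 𝟭 (FreePACat k) := by
    rw [← functor_mul, mul_inv_cancel, functor_one]
  exact ⟨(eqToIso h1).symm ≪≫ (Functor.isoWhiskerLeft (functor Φ⁻¹) e).symm⟩

end AutPACat

/-- The subgroup of all inner automorphisms. -/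
def innerPACat (k : Type u) [Field k] : Subgroup (AutPACat k) where
  carrier := {Φ | Φ.IsInner}
  one_mem' := AutPACat.IsInner.one
  mul_mem' h h' := h.mul h'
  inv_mem' h := h.inv

instance innerPACat_normal (k : Type u) [Field k] : (innerPACat k).Normal where
  conj_mem _ h Ψ := AutPACat.IsInner.conj h Ψ

/-! ### Strongly stable automorphisms -/

namespace AutPACat

variable {k : Type u} [Field k]

/-- `s` is a system of bijections `s_F : F → F` witnessing that `Φ` is strongly stable: `Φ`
preserves all objects, `Φ(ψ) = s_F ψ s_D⁻¹` for every `ψ : D → F`, and `s_F` is the identity on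
the free generators of `F`. -/
structure IsBijectionSystem (Φ : AutPACat k) (s : ∀ X : FreePACat k, X.Alg ≃ X.Alg) : Prop where
  obj_eq : ∀ X, (functor Φ).obj X = X
  map_eq : ∀ {D F : FreePACat k} (ψ : D ⟶ F) (f : D.Alg),
    (eqToHom (obj_eq D).symm ≫ (functor Φ).map ψ ≫ eqToHom (obj_eq F)).toAlgHom f =
      s F (ψ.toAlgHom ((s D).symm f))
  gen_eq : ∀ (X : FreePACat k) (x : X.gens),
    s X (FreePowerAssoc.of k x) = FreePowerAssoc.of k x

/-- Strongly stable automorphisms. -/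
def IsStronglyStable (Φ : AutPACat k) : Prop := ∃ s, Φ.IsBijectionSystem s

/-- `Φ` is the strongly stable automorphism given by the system of words
`w_λ = φ(λ) x`, `w₊ = x₁ + x₂`, `w· = α x₁ x₂ + β x₂ x₁`: its bijections `s_F` are isomorphisms
from `F` onto the set `F` with the operations defined by these words. -/
def IsGivenByWords (Φ : AutPACat k) (φ : RingAut k) (α β : k) : Prop :=
  ∃ s : ∀ X : FreePACat k, X.Alg ≃ X.Alg, Φ.IsBijectionSystem s ∧
    ∀ X : FreePACat k,
      (∀ (c : k) (f : X.Alg), s X (c • f) = φ c • s X f) ∧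
      (∀ f g : X.Alg, s X (f + g) = s X f + s X g) ∧
      (∀ f g : X.Alg, s X (f * g) = α • (s X f * s X g) + β • (s X g * s X f))

end AutPACat

/-- The natural action of the group of field automorphisms on the multiplicative group. -/
def fieldAutAction (k : Type u) [Field k] : RingAut k →* MulAut kˣ where
  toFun φ := Units.mapEquiv φ.toMulEquiv
  map_one' := rfl
  map_mul' _ _ := rfl

end

/-!
An automorphism `Φ` of the category preserves the free algebra `F(x)` on one generator up to
isomorphism: `F(x)` is a retract of every nonzero object, and a retract of `F(x)` is commutative,
so that it has at most one generator (`FreePACat.nonempty_iso_point`). As `F(x)` represents the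
underlying set, `Φ` comes with natural bijections `σ_X : X → Φ(X)`
(`FreePACat.exists_isNaturalSystem`). The elements `σ_X(x)`, `x` a generator, form a free basis of
`Φ(X)`, so up to an isomorphism of functors `Φ(ψ) = s_F ψ s_D⁻¹` with bijections `s_F : F → F` that
fix the generators.

The operations transported along `s` are given by words, and these are computed in
`FreePACat.IsNormalSystem.exists_words`. The words `w_c ∈ F(x)`, `c ≠ 0`, are invertible under
substitution. Since `F(x)` embeds into `k[t]`, they have degree one, so `w_c = φ(c) x`. The words for
the sum and the product are then homogeneous of degrees one and two, because they are compatible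
with all rescalings and `k` is infinite; substituting zero for one of the generators leaves
`x₁ + x₂` and `α x₁ x₂ + β x₂ x₁`. If `α = β`, then `s (x₁ x₂) = s (x₂ x₁)`, and if `α = -β`, then
`s (x₁ x₁) = 0`; both contradict injectivity. Conversely, on the powers of one element the
multiplication `α f g + β g f` is the old one times `α + β`, so the twisted algebra is again
power-associative; the universal property gives the maps `s_F`, and they are bijective because
`α² ≠ β²`.

A natural system for a given `Φ` is unique up to a scalar, since the quotient of two systems is
again an invertible word in one variable. So `φ` and the ratio `α : β` are invariants of `Φ`.
Composition multiplies `α ± β` as `(α ± β) φ(γ ± δ)`, hence `Φ ↦ ((α + β) / (α - β), φ)` is a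
homomorphism onto `kˣ ⋊ Aut k`. Its kernel consists of the `Φ` with `φ = 1` and `β = 0`; then
`α s` is a natural isomorphism of algebras, so the kernel is the group of inner automorphisms.
-/

/-! ### Twisted homomorphisms -/

section Twist

variable {k : Type u} [Field k]

/-- A map `s : A → B` that is a homomorphism from `A` to `B` with the operations given by the
words `φ(λ) x`, `x₁ + x₂` and `α x₁ x₂ + β x₂ x₁`. -/
structure IsTwistedHom {A B : Type u} [NonUnitalNonAssocRing A] [Module k A]
    [NonUnitalNonAssocRing B] [Module k B] (φ : RingAut k) (α β : k) (s : A → B) : Prop where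
  smul : ∀ (c : k) (f : A), s (c • f) = φ c • s f
  add : ∀ f g : A, s (f + g) = s f + s g
  mul : ∀ f g : A, s (f * g) = α • (s f * s g) + β • (s g * s f)

namespace IsTwistedHom

variable {A B C : Type u} [NonUnitalNonAssocRing A] [Module k A] [NonUnitalNonAssocRing B]
  [Module k B] [NonUnitalNonAssocRing C] [Module k C]

theorem id : IsTwistedHom (1 : RingAut k) 1 0 (id : A → A) :=
  ⟨fun _ _ => rfl, fun _ _ => rfl, fun _ _ => by simp⟩

theorem of_algHom (h : A →ₙₐ[k] B) : IsTwistedHom (1 : RingAut k) 1 0 h :=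
  ⟨fun c f => map_smul h c f, fun f g => map_add h f g, fun f g => by simp⟩

theorem map_zero {φ : RingAut k} {α β : k} {s : A → B} (h : IsTwistedHom φ α β s) : s 0 = 0 := by
  simpa using h.smul 0 0

/-- The algebra homomorphism underlying an untwisted map. -/
def toAlgHom {s : A → B} (h : IsTwistedHom (1 : RingAut k) 1 0 s) : A →ₙₐ[k] B where
  toFun := s
  map_smul' := h.smul
  map_zero' := h.map_zero
  map_add' := h.add
  map_mul' f g := by simpa using h.mul f g

theorem comp {φ ψ : RingAut k} {α β γ δ : k} {s : B → C} {t : A → B}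
    (hs : IsTwistedHom φ α β s) (ht : IsTwistedHom ψ γ δ t) :
    IsTwistedHom (φ * ψ) (φ γ * α + φ δ * β) (φ γ * β + φ δ * α) (s ∘ t) where
  smul c f := by simp only [Function.comp, ht.smul, hs.smul]; rfl
  add f g := by simp only [Function.comp, ht.add, hs.add]
  mul f g := by
    simp only [Function.comp, ht.mul, hs.add, hs.smul, hs.mul]
    module

theorem comp_algHom {φ : RingAut k} {α β : k} {s : B → C}
    (hs : IsTwistedHom φ α β s) (h : A →ₙₐ[k] B) : IsTwistedHom φ α β (fun f => s (h f)) where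
  smul c f := by simp only [map_smul, hs.smul]
  add f g := by simp only [map_add, hs.add]
  mul f g := by simp only [map_mul, hs.mul]

theorem algHom_comp {φ : RingAut k} {α β : k} (h : B →ₙₐ[k] C) {s : A → B}
    (hs : IsTwistedHom φ α β s) : IsTwistedHom φ α β (fun f => h (s f)) where
  smul c f := by simp only [hs.smul, map_smul]
  add f g := by simp only [hs.add, map_add]
  mul f g := by simp only [hs.mul, map_add, map_smul, map_mul]

/-- Multiplying a twisted homomorphism by `a` divides its multiplication word by `a`. -/
theorem smul_left {φ : RingAut k} {α β : k} [IsScalarTower k B B] [SMulCommClass k B B]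
    {s : A → B} (hs : IsTwistedHom φ α β s) {a : k} (ha : a ≠ 0) :
    IsTwistedHom φ (a⁻¹ * α) (a⁻¹ * β) fun f => a • s f where
  smul c f := by rw [hs.smul, smul_comm]
  add f g := by rw [hs.add, smul_add]
  mul f g := by
    have h' : a⁻¹ * α * (a * a) = a * α := by field_simp
    have h'' : a⁻¹ * β * (a * a) = a * β := by field_simp
    rw [hs.mul, smul_mul_smul_comm, smul_mul_smul_comm, smul_smul _ (a * a), smul_smul _ (a * a),
      h', h'', smul_add, smul_smul, smul_smul]

section inverse

variable {φ : RingAut k} {α β : k}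

theorem sq_sub_sq_ne_zero (h : α ≠ β) (h' : α ≠ -β) : α ^ 2 - β ^ 2 ≠ 0 := by
  have : α ^ 2 - β ^ 2 = (α - β) * (α + β) := by ring
  rw [this]
  exact mul_ne_zero (sub_ne_zero.2 h) fun h0 => h' (eq_neg_of_add_eq_zero_left h0)

theorem comp_inverse {s : A → B} {t : C → A} (h : α ≠ β) (h' : α ≠ -β) (hs : IsTwistedHom φ α β s)
    (ht : IsTwistedHom φ⁻¹ (φ⁻¹ (α / (α ^ 2 - β ^ 2))) (φ⁻¹ (-β / (α ^ 2 - β ^ 2))) t) :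
    IsTwistedHom (1 : RingAut k) 1 0 (s ∘ t) := by
  have hD := sq_sub_sq_ne_zero h h'
  have hφ : ∀ c, φ (φ⁻¹ c) = c := fun c => φ.apply_symm_apply c
  have hst := hs.comp ht
  have e1 : α / (α ^ 2 - β ^ 2) * α + -β / (α ^ 2 - β ^ 2) * β = 1 := by field_simp; ring
  have e2 : α / (α ^ 2 - β ^ 2) * β + -β / (α ^ 2 - β ^ 2) * α = 0 := by field_simp; ring
  rwa [mul_inv_cancel, hφ, hφ, e1, e2] at hst

theorem inverse_comp {s : A → B} {t : B → C} (h : α ≠ β) (h' : α ≠ -β) (hs : IsTwistedHom φ α β s)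
    (ht : IsTwistedHom φ⁻¹ (φ⁻¹ (α / (α ^ 2 - β ^ 2))) (φ⁻¹ (-β / (α ^ 2 - β ^ 2))) t) :
    IsTwistedHom (1 : RingAut k) 1 0 (t ∘ s) := by
  have hD := sq_sub_sq_ne_zero h h'
  have hts := ht.comp hs
  have e3 : α * (α / (α ^ 2 - β ^ 2)) + β * (-β / (α ^ 2 - β ^ 2)) = 1 := by field_simp; ring
  have e4 : α * (-β / (α ^ 2 - β ^ 2)) + β * (α / (α ^ 2 - β ^ 2)) = 0 := by field_simp; ring
  rwa [inv_mul_cancel, ← map_mul, ← map_mul, ← map_mul, ← map_mul, ← map_add, ← map_add, e3, e4,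
    map_one, _root_.map_zero] at hts

/-- The words of the inverse solve the linear system for `x₁ x₂` and `x₂ x₁` with determinant
`α² - β²`. -/
theorem symm {s : A ≃ B} (h : α ≠ β) (h' : α ≠ -β) (hs : IsTwistedHom φ α β s) :
    IsTwistedHom φ⁻¹ (φ⁻¹ (α / (α ^ 2 - β ^ 2))) (φ⁻¹ (-β / (α ^ 2 - β ^ 2))) s.symm := by
  have hD := sq_sub_sq_ne_zero h h'
  have hφ : ∀ c, φ (φ⁻¹ c) = c := fun c => φ.apply_symm_apply c
  refine ⟨fun c f => ?_, fun f g => ?_, fun f g => ?_⟩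
  · rw [Equiv.symm_apply_eq, hs.smul, hφ, Equiv.apply_symm_apply]
  · rw [Equiv.symm_apply_eq, hs.add, Equiv.apply_symm_apply, Equiv.apply_symm_apply]
  · have e1 : α / (α ^ 2 - β ^ 2) * α + -β / (α ^ 2 - β ^ 2) * β = 1 := by field_simp; ring
    have e2 : α / (α ^ 2 - β ^ 2) * β + -β / (α ^ 2 - β ^ 2) * α = 0 := by field_simp; ring
    rw [Equiv.symm_apply_eq, hs.add, hs.smul, hs.smul, hφ, hφ, hs.mul, hs.mul,
      Equiv.apply_symm_apply, Equiv.apply_symm_apply]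
    calc f * g = (1 : k) • (f * g) + (0 : k) • (g * f) := by rw [one_smul, zero_smul, add_zero]
      _ = _ := by rw [← e1, ← e2]; module

end inverse

end IsTwistedHom

/-- The vector space `A` with scalars acting through `φ` and with the multiplication
`f ∗ g = α f g + β g f`. -/
def Twist (_φ : RingAut k) (_α _β : k) (A : Type u) : Type u := A

namespace Twist

variable (φ : RingAut k) (α β : k) {A : Type u} [NonUnitalNonAssocRing A]

/-- The identity map from `A` to its twist. -/
def toTwist : A ≃ Twist φ α β A := Equiv.refl A

instance : AddCommGroup (Twist φ α β A) := inferInstanceAs (AddCommGroup A)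

theorem toTwist_add (f g : A) :
    toTwist φ α β (f + g) = toTwist φ α β f + toTwist φ α β g := rfl

theorem toTwist_zero : toTwist φ α β (0 : A) = 0 := rfl

variable [Module k A]

instance : Module k (Twist φ α β A) where
  smul c f := toTwist φ α β (φ c • (toTwist φ α β).symm f)
  one_smul f := by
    change toTwist φ α β (φ 1 • (toTwist φ α β).symm f) = f
    simp
  mul_smul c d f := by
    change toTwist φ α β (φ (c * d) • (toTwist φ α β).symm f) =
      toTwist φ α β (φ c • φ d • (toTwist φ α β).symm f)
    rw [map_mul, mul_smul]
  smul_zero c := smul_zero (A := A) (φ c)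
  smul_add c f g := smul_add (A := A) (φ c) f g
  add_smul c d f := by
    change toTwist φ α β (φ (c + d) • (toTwist φ α β).symm f) =
      toTwist φ α β (φ c • (toTwist φ α β).symm f + φ d • (toTwist φ α β).symm f)
    rw [map_add, add_smul]
  zero_smul f := by
    change toTwist φ α β (φ 0 • (toTwist φ α β).symm f) = toTwist φ α β 0
    rw [map_zero, zero_smul]

theorem smul_toTwist (c : k) (f : A) :
    c • toTwist φ α β f = toTwist φ α β (φ c • f) := rfl

instance : Mul (Twist φ α β A) where
  mul f g := toTwist φ α β (α • ((toTwist φ α β).symm f * (toTwist φ α β).symm g) +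
    β • ((toTwist φ α β).symm g * (toTwist φ α β).symm f))

theorem toTwist_mul (f g : A) :
    toTwist φ α β f * toTwist φ α β g = toTwist φ α β (α • (f * g) + β • (g * f)) := rfl

instance : NonUnitalNonAssocRing (Twist φ α β A) where
  left_distrib a b c := by
    obtain ⟨a, rfl⟩ := (toTwist φ α β).surjective a
    obtain ⟨b, rfl⟩ := (toTwist φ α β).surjective b
    obtain ⟨c, rfl⟩ := (toTwist φ α β).surjective c
    simp only [← toTwist_add, toTwist_mul, mul_add, add_mul, smul_add]
    congr 1
    abel
  right_distrib a b c := by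
    obtain ⟨a, rfl⟩ := (toTwist φ α β).surjective a
    obtain ⟨b, rfl⟩ := (toTwist φ α β).surjective b
    obtain ⟨c, rfl⟩ := (toTwist φ α β).surjective c
    simp only [← toTwist_add, toTwist_mul, mul_add, add_mul, smul_add]
    congr 1
    abel
  zero_mul a := by
    obtain ⟨a, rfl⟩ := (toTwist φ α β).surjective a
    rw [← toTwist_zero, toTwist_mul]
    simp
  mul_zero a := by
    obtain ⟨a, rfl⟩ := (toTwist φ α β).surjective a
    rw [← toTwist_zero, toTwist_mul]
    simp

variable [IsScalarTower k A A] [SMulCommClass k A A]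

instance : IsScalarTower k (Twist φ α β A) (Twist φ α β A) where
  smul_assoc t a b := by
    obtain ⟨a, rfl⟩ := (toTwist φ α β).surjective a
    obtain ⟨b, rfl⟩ := (toTwist φ α β).surjective b
    simp only [smul_eq_mul, toTwist_mul, smul_toTwist, smul_mul_assoc, mul_smul_comm, smul_add,
      smul_comm (φ t)]

instance : SMulCommClass k (Twist φ α β A) (Twist φ α β A) where
  smul_comm t a b := by
    obtain ⟨a, rfl⟩ := (toTwist φ α β).surjective a
    obtain ⟨b, rfl⟩ := (toTwist φ α β).surjective b
    simp only [smul_eq_mul, toTwist_mul, smul_toTwist, smul_mul_assoc, mul_smul_comm, smul_add,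
      smul_comm (φ t)]

/-- Powers of one element of a power-associative algebra commute, so that on them the twisted
multiplication is the old one multiplied by `α + β`. -/
theorem lift_toTwist (hA : IsPowerAssociative A) (a : A) (u : FreeMagma Unit) :
    FreeMagma.lift (fun _ => toTwist φ α β a) u =
      toTwist φ α β ((α + β) ^ (u.length - 1) • FreeMagma.lift (fun _ => a) u) := by
  induction u with
  | ih1 x => simp
  | ih2 u v hu hv =>
    have hcomm : FreeMagma.lift (fun _ => a) v * FreeMagma.lift (fun _ => a) u =
        FreeMagma.lift (fun _ => a) u * FreeMagma.lift (fun _ => a) v := by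
      rw [← map_mul, ← map_mul]
      exact hA _ _ (by simp [add_comm]) a
    have hlen : (u * v).length - 1 = (u.length - 1) + (v.length - 1) + 1 := by
      have := u.length_pos
      have := v.length_pos
      simp only [FreeMagma.length]
      omega
    rw [map_mul, map_mul, hu, hv, toTwist_mul, hlen]
    simp only [smul_mul_assoc, mul_smul_comm, hcomm]
    congr 1
    module

/-- A twist of a power-associative algebra is power-associative. -/
theorem isPowerAssociative (hA : IsPowerAssociative A) :
    IsPowerAssociative (Twist φ α β A) := by
  intro u v h a
  obtain ⟨a, rfl⟩ := (toTwist φ α β).surjective a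
  rw [lift_toTwist φ α β hA, lift_toTwist φ α β hA, h, hA u v h a]

end Twist

/-! ### Lifting homomorphisms and twisted homomorphisms from the free algebra -/

namespace FreePowerAssoc

section lift

variable {X : Type} {A : Type*} [NonUnitalNonAssocRing A] [Module k A]
    [IsScalarTower k A A] [SMulCommClass k A A]

/-- The homomorphism from `F(X)` to a power-associative algebra with given values on `X`. -/
noncomputable def lift (hA : IsPowerAssociative A) (f : X → A) : FreePowerAssoc k X →ₙₐ[k] A :=
  (existsUnique_lift k X hA f).choose

@[simp]
theorem lift_of (hA : IsPowerAssociative A) (f : X → A) (x : X) : lift hA f (of k x) = f x :=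
  (existsUnique_lift k X hA f).choose_spec.1 x

theorem hom_ext (hA : IsPowerAssociative A) {g h : FreePowerAssoc k X →ₙₐ[k] A}
    (H : ∀ x, g (of k x) = h (of k x)) : g = h :=
  (existsUnique_lift k X hA fun x => h (of k x)).unique H fun _ => rfl

end lift

section twistedLift

variable {X : Type} {A : Type u} [NonUnitalNonAssocRing A] [Module k A]
    [IsScalarTower k A A] [SMulCommClass k A A]

theorem exists_twistedHom (hA : IsPowerAssociative A) (φ : RingAut k) (α β : k) (f : X → A) :
    ∃ s : FreePowerAssoc k X → A, IsTwistedHom φ α β s ∧ ∀ x, s (of k x) = f x := by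
  let g : FreePowerAssoc k X →ₙₐ[k] Twist φ α β A :=
    lift (Twist.isPowerAssociative φ α β hA) fun x => Twist.toTwist φ α β (f x)
  exact ⟨fun a => (Twist.toTwist φ α β).symm (g a),
    ⟨fun c a => congrArg (Twist.toTwist φ α β).symm (map_smul g c a),
      fun a b => congrArg (Twist.toTwist φ α β).symm (map_add g a b),
      fun a b => congrArg (Twist.toTwist φ α β).symm (map_mul g a b)⟩,
    fun x => congrArg (Twist.toTwist φ α β).symm
      (lift_of (Twist.isPowerAssociative φ α β hA) _ x)⟩

/-- A twisted homomorphism on `F(X)` is a homomorphism to the twist of the target, hence is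
determined by its values on `X`. -/
theorem twistedHom_ext (hA : IsPowerAssociative A) {φ : RingAut k} {α β : k}
    {s t : FreePowerAssoc k X → A} (hs : IsTwistedHom φ α β s) (ht : IsTwistedHom φ α β t)
    (h : ∀ x, s (of k x) = t (of k x)) : s = t := by
  have key : ∀ {r : FreePowerAssoc k X → A}, IsTwistedHom φ α β r →
      ∃ g : FreePowerAssoc k X →ₙₐ[k] Twist φ α β A, ∀ a, g a = Twist.toTwist φ α β (r a) :=
    fun {r} hr => ⟨{
      toFun := fun a => Twist.toTwist φ α β (r a)
      map_smul' := fun c a => congrArg (Twist.toTwist φ α β) (hr.smul c a)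
      map_zero' := congrArg (Twist.toTwist φ α β) hr.map_zero
      map_add' := fun a b => congrArg (Twist.toTwist φ α β) (hr.add a b)
      map_mul' := fun a b => congrArg (Twist.toTwist φ α β) (hr.mul a b) }, fun _ => rfl⟩
  obtain ⟨g, hg⟩ := key hs
  obtain ⟨g', hg'⟩ := key ht
  have hgg : g = g' := hom_ext (Twist.isPowerAssociative φ α β hA) fun x => by rw [hg, hg', h]
  funext a
  exact (Twist.toTwist φ α β).injective (by rw [← hg, ← hg', hgg])

/-- If `α ≠ ± β`, the twisted endomorphism of `F(X)` that fixes `X` is bijective: its inverse is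
the twisted endomorphism for `φ⁻¹` and the preimages under `φ` of `α / (α² - β²)` and
`-β / (α² - β²)`. -/
theorem exists_twistedEquiv (X : Type) (φ : RingAut k) {α β : k} (h : α ≠ β) (h' : α ≠ -β) :
    ∃ s : FreePowerAssoc k X ≃ FreePowerAssoc k X,
      IsTwistedHom φ α β s ∧ ∀ x, s (of k x) = of k x := by
  obtain ⟨s, hs, hs1⟩ := exists_twistedHom (isPowerAssociative k X) φ α β (of k)
  obtain ⟨t, ht, ht1⟩ := exists_twistedHom (isPowerAssociative k X) φ⁻¹
    (φ⁻¹ (α / (α ^ 2 - β ^ 2))) (φ⁻¹ (-β / (α ^ 2 - β ^ 2))) (of k)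
  have h1 := twistedHom_ext (isPowerAssociative k X) (hs.comp_inverse h h' ht) .id
    fun x => by simp [ht1, hs1]
  have h2 := twistedHom_ext (isPowerAssociative k X) (hs.inverse_comp h h' ht) .id
    fun x => by simp [ht1, hs1]
  exact ⟨⟨s, t, fun a => congrFun h2 a, fun a => congrFun h1 a⟩, hs, hs1⟩

end twistedLift

end FreePowerAssoc

end Twist

/-! ### Monomials and homogeneous elements of the free algebra -/

theorem FreeMagma.length_mul {X : Type*} (m n : FreeMagma X) :
    (m * n).length = m.length + n.length := rfl

theorem FreeMagma.length_eq_one {X : Type*} {m : FreeMagma X} (h : m.length = 1) :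
    ∃ x, m = FreeMagma.of x := by
  induction m with
  | ih1 x => exact ⟨x, rfl⟩
  | ih2 m n _ _ =>
    have := m.length_pos
    have := n.length_pos
    simp only [FreeMagma.length] at h
    omega

theorem FreeMagma.length_eq_two {X : Type*} {m : FreeMagma X} (h : m.length = 2) :
    ∃ x y, m = FreeMagma.of x * FreeMagma.of y := by
  induction m with
  | ih1 x => simp [FreeMagma.length] at h
  | ih2 m n _ _ =>
    have := m.length_pos
    have := n.length_pos
    simp only [FreeMagma.length] at h
    obtain ⟨x, rfl⟩ := FreeMagma.length_eq_one (m := m) (by omega)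
    obtain ⟨y, rfl⟩ := FreeMagma.length_eq_one (m := n) (by omega)
    exact ⟨x, y, rfl⟩

namespace FreePowerAssoc

variable {k : Type u} [Field k] {X : Type}

/-- The value in `F(X)` of a bracketed word in the generators. -/
noncomputable def monomial (k : Type u) [Field k] (m : FreeMagma X) : FreePowerAssoc k X :=
  FreeMagma.lift (of k) m

@[simp]
theorem monomial_of (x : X) : monomial k (FreeMagma.of x) = of k x := rfl

theorem monomial_mul (m n : FreeMagma X) : monomial k (m * n) = monomial k m * monomial k n :=
  map_mul _ m n

theorem span_range_monomial : Submodule.span k (Set.range (monomial k (X := X))) = ⊤ := by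
  refine eq_top_iff.2 fun f _ => ?_
  obtain ⟨a, rfl⟩ := mk_surjective k X f
  have hmk : ∀ m : FreeMagma X, mk k X (MonoidAlgebra.ofMagma k _ m) = monomial k m := by
    intro m
    induction m with
    | ih1 x => rfl
    | ih2 m n hm hn => rw [map_mul, map_mul, hm, hn, monomial_mul]
  induction a using MonoidAlgebra.induction_linear with
  | zero => simp
  | add a b ha hb => rw [map_add]; exact add_mem (ha trivial) (hb trivial)
  | single m c =>
    have h1 : (MonoidAlgebra.single m c : MonoidAlgebra k (FreeMagma X)) =
        c • MonoidAlgebra.ofMagma k _ m := by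
      simp
    rw [h1, map_smul, hmk]
    exact Submodule.smul_mem _ _ (Submodule.subset_span ⟨m, rfl⟩)

/-- The endomorphism of `F(X)` that multiplies every generator by `c`. -/
noncomputable def rescale (c : k) : FreePowerAssoc k X →ₙₐ[k] FreePowerAssoc k X :=
  lift (isPowerAssociative k X) fun x => c • of k x

@[simp]
theorem rescale_of (c : k) (x : X) : rescale c (of k x) = c • of k x :=
  lift_of _ _ x

theorem rescale_monomial (c : k) (m : FreeMagma X) :
    rescale c (monomial k m) = c ^ m.length • monomial k m := by
  induction m with
  | ih1 x => simp [FreeMagma.length]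
  | ih2 m n hm hn =>
    rw [monomial_mul, map_mul, hm, hn, FreeMagma.length_mul, pow_add, smul_mul_smul_comm]

/-- If every rescaling of the generators by `c` multiplies `f` by `c ^ d`, then `f` is a
combination of monomials of degree `d`. -/
theorem mem_span_of_rescale_eq [Infinite k] {d : ℕ} {f : FreePowerAssoc k X}
    (h : ∀ c : k, rescale c f = c ^ d • f) :
    f ∈ Submodule.span k (monomial k '' {m : FreeMagma X | m.length = d}) := by
  classical
  by_contra hf
  obtain ⟨l, hl, hker⟩ := Submodule.exists_le_ker_of_notMem hf
  have hzero : ∀ m : FreeMagma X, m.length = d → l (monomial k m) = 0 := fun m hm =>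
    hker (Submodule.subset_span ⟨m, hm, rfl⟩)
  have hspan : f ∈ Submodule.span k (Set.range (monomial k (X := X))) := by
    rw [span_range_monomial]; trivial
  obtain ⟨a, ha⟩ := (Finsupp.mem_span_range_iff_exists_finsupp).1 hspan
  -- The polynomial in `c` obtained by applying `l` to `rescale c f - c ^ d • f`.
  let p : Polynomial k := (a.sum fun m b => Polynomial.monomial m.length (b * l (monomial k m))) -
    Polynomial.monomial d (l f)
  have hp : p = 0 := by
    refine Polynomial.funext fun c => ?_
    have h1 : l (rescale c f) = a.sum fun m b => c ^ m.length * (b * l (monomial k m)) := by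
      rw [← ha]
      simp only [Finsupp.sum, map_sum, map_smul, rescale_monomial, smul_eq_mul]
      exact Finset.sum_congr rfl fun m _ => by ring
    have h2 : l (rescale c f) = c ^ d * l f := by rw [h c, map_smul, smul_eq_mul]
    simp only [p, Finsupp.sum, Polynomial.eval_sub, Polynomial.eval_finsetSum,
      Polynomial.eval_monomial, Polynomial.eval_zero]
    rw [sub_eq_zero, mul_comm (l f), ← h2, h1]
    exact Finset.sum_congr rfl fun m _ => by ring
  have hcoeff := congrArg (fun q => Polynomial.coeff q d) hp
  simp only [p, Finsupp.sum, Polynomial.coeff_sub, Polynomial.finsetSum_coeff,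
    Polynomial.coeff_monomial, Polynomial.coeff_zero, if_true] at hcoeff
  rw [Finset.sum_eq_zero, zero_sub, neg_eq_zero] at hcoeff
  · exact hl hcoeff
  · intro m _
    split_ifs with hm
    · rw [hzero m hm, mul_zero]
    · rfl

/-! ### The components of degree at most two -/

/-- The free nilpotent algebra of class two on `X`: pairs of a linear and a bilinear form, with
`(v, p) (w, q) = (0, v ⊗ w)`. -/
def Truncation (k : Type u) (X : Type) : Type u := (X → k) × (X → X → k)

namespace Truncation

noncomputable instance : AddCommGroup (Truncation k X) :=
  inferInstanceAs (AddCommGroup ((X → k) × (X → X → k)))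

noncomputable instance : Module k (Truncation k X) :=
  inferInstanceAs (Module k ((X → k) × (X → X → k)))

instance : Mul (Truncation k X) where
  mul a b := (0, fun x y => a.1 x * b.1 y)

@[simp] theorem fst_mul (a b : Truncation k X) : (a * b).1 = 0 := rfl

@[simp] theorem snd_mul (a b : Truncation k X) (x y : X) : (a * b).2 x y = a.1 x * b.1 y := rfl

@[simp] theorem fst_add (a b : Truncation k X) : (a + b).1 = a.1 + b.1 := rfl

@[simp] theorem snd_add (a b : Truncation k X) : (a + b).2 = a.2 + b.2 := rfl

@[simp] theorem fst_smul (c : k) (a : Truncation k X) : (c • a).1 = c • a.1 := rfl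

@[simp] theorem snd_smul (c : k) (a : Truncation k X) : (c • a).2 = c • a.2 := rfl

@[simp] theorem fst_zero : (0 : Truncation k X).1 = 0 := rfl

@[simp] theorem snd_zero : (0 : Truncation k X).2 = 0 := rfl

theorem ext {k : Type u} {X : Type} {a b : Truncation k X} (h : ∀ x, a.1 x = b.1 x)
    (h' : ∀ x y, a.2 x y = b.2 x y) : a = b :=
  Prod.ext (funext h) (funext fun x => funext (h' x))

noncomputable instance : NonUnitalNonAssocRing (Truncation k X) where
  left_distrib a b c := ext (by simp) (by simp [mul_add])
  right_distrib a b c := ext (by simp) (by simp [add_mul])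
  zero_mul a := ext (by simp) (by simp)
  mul_zero a := ext (by simp) (by simp)

instance : IsScalarTower k (Truncation k X) (Truncation k X) where
  smul_assoc c a b := ext (by simp) (by simp [mul_assoc])

instance : SMulCommClass k (Truncation k X) (Truncation k X) where
  smul_comm c a b := ext (by simp) (by simp [mul_left_comm])

theorem lift_eq (a : Truncation k X) (u : FreeMagma Unit) :
    FreeMagma.lift (fun _ => a) u =
      if u.length = 1 then a else if u.length = 2 then a * a else 0 := by
  have hfst : ∀ v : FreeMagma Unit, v.length ≠ 1 → (FreeMagma.lift (fun _ => a) v).1 = 0 := by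
    intro v hv
    induction v with
    | ih1 x => simp [FreeMagma.length] at hv
    | ih2 v w _ _ => rw [map_mul]; rfl
  induction u with
  | ih1 x => simp [FreeMagma.length]
  | ih2 u v hu hv =>
    have h1 := u.length_pos
    have h2 := v.length_pos
    rw [map_mul, if_neg (by simp only [FreeMagma.length]; omega)]
    by_cases hu1 : u.length = 1
    · by_cases hv1 : v.length = 1
      · rw [hu, hv, if_pos hu1, if_pos hv1, if_pos (by simp only [FreeMagma.length]; omega)]
      · rw [if_neg (by simp only [FreeMagma.length]; omega)]
        exact ext (by simp) (by simp [hfst v hv1])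
    · rw [if_neg (by simp only [FreeMagma.length]; omega)]
      exact ext (by simp) (by simp [hfst u hu1])

theorem isPowerAssociative : IsPowerAssociative (Truncation k X) := by
  intro u v h a
  rw [lift_eq, lift_eq, h]

end Truncation

/-- The homomorphism that forgets the components of degree greater than two. -/
noncomputable def truncate [DecidableEq X] : FreePowerAssoc k X →ₙₐ[k] Truncation k X :=
  lift Truncation.isPowerAssociative fun x => (Pi.single x 1, 0)

theorem truncate_mul_of [DecidableEq X] (x y a b : X) :
    (truncate (of k x * of k y)).2 a b =
      (Pi.single x 1 : X → k) a * (Pi.single y 1 : X → k) b := by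
  have h : ∀ x : X, (truncate (of k x)).1 = (Pi.single x 1 : X → k) := fun x =>
    congrArg Prod.fst (lift_of (Truncation.isPowerAssociative (k := k) (X := X)) _ x)
  rw [map_mul, Truncation.snd_mul, h, h]

theorem mul_of_ne_zero (x y : X) : of k x * of k y ≠ 0 := by
  classical
  intro h
  have h1 := truncate_mul_of (k := k) x y x y
  rw [h, map_zero] at h1
  simp at h1

theorem of_ne_zero (x : X) : of k x ≠ 0 := fun h => mul_of_ne_zero (k := k) x x (by simp [h])

theorem eq_of_mul_of_comb_eq {x y : X} (hxy : x ≠ y) {α β α' β' : k}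
    (h : α • (of k x * of k y) + β • (of k y * of k x) =
      α' • (of k x * of k y) + β' • (of k y * of k x)) : α = α' ∧ β = β' := by
  classical
  have h1 : ∀ a b : X, (truncate _).2 a b = (truncate _).2 a b := fun a b =>
    congrArg (fun t => (truncate t).2 a b) h
  have h2 := h1 x y
  have h3 := h1 y x
  simp only [map_add, map_smul, Truncation.snd_add, Truncation.snd_smul, Pi.add_apply,
    Pi.smul_apply, truncate_mul_of] at h2 h3
  simp [hxy, hxy.symm] at h2 h3
  exact ⟨h2, h3⟩

theorem mul_of_ne_mul_of {x y : X} (hxy : x ≠ y) : of k x * of k y ≠ of k y * of k x := by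
  intro h
  have := (eq_of_mul_of_comb_eq (k := k) (α := 1) (β := 0) (α' := 0) (β' := 1) hxy
    (by simpa using h)).1
  exact one_ne_zero this

/-! ### The free algebra on one generator -/

section Unique

theorem isPowerAssociative_of_monoid {A : Type*} [Monoid A] : IsPowerAssociative A := by
  have key : ∀ (a : A) (u : FreeMagma Unit), FreeMagma.lift (fun _ => a) u = a ^ u.length := by
    intro a u
    induction u with
    | ih1 x => simp [FreeMagma.length]
    | ih2 u v hu hv => rw [map_mul, hu, hv, FreeMagma.length_mul, pow_add]
  intro u v h a
  rw [key, key, h]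

/-- The homomorphism from `F(X)` to `k[t]` that sends all the generators to `t`. If `X` has one
element, it identifies `F(X)` with the polynomials without constant term. -/
noncomputable def toPoly : FreePowerAssoc k X →ₙₐ[k] Polynomial k :=
  lift isPowerAssociative_of_monoid fun _ => Polynomial.X

@[simp]
theorem toPoly_of (x : X) : toPoly (of k x) = Polynomial.X := lift_of _ _ x

theorem toPoly_coeff_zero (f : FreePowerAssoc k X) : (toPoly f).coeff 0 = 0 := by
  have h : ((Polynomial.aeval (R := k) (0 : k) : Polynomial k →ₐ[k] k) :
      Polynomial k →ₙₐ[k] k).comp (toPoly (X := X)) = 0 :=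
    hom_ext isPowerAssociative_of_monoid fun x => by
      change Polynomial.aeval (0 : k) (toPoly (of k x)) = 0
      simp
  have h1 : Polynomial.aeval (0 : k) (toPoly f) = 0 := DFunLike.congr_fun h f
  simpa [Polynomial.coeff_zero_eq_eval_zero] using h1

theorem toPoly_monomial (m : FreeMagma X) :
    toPoly (monomial k m) = Polynomial.monomial m.length 1 := by
  induction m with
  | ih1 x => simp [FreeMagma.length, Polynomial.X]
  | ih2 m n hm hn =>
    rw [monomial_mul, map_mul, hm, hn, FreeMagma.length_mul, Polynomial.monomial_mul_monomial,
      one_mul]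

variable [Unique X]

theorem monomial_eq_of_length_eq {m n : FreeMagma X} (h : m.length = n.length) :
    monomial k m = monomial k n := by
  have key : ∀ m : FreeMagma X, monomial k m =
      FreeMagma.lift (fun _ => of k default) (FreeMagma.map (fun _ => ()) m) ∧
      (FreeMagma.map (fun _ => ()) m).length = m.length := by
    intro m
    induction m with
    | ih1 x => exact ⟨by simp [Unique.eq_default x], by simp [FreeMagma.length]⟩
    | ih2 m n hm hn =>
      exact ⟨by rw [monomial_mul, map_mul, map_mul, hm.1, hn.1],
        by rw [map_mul, FreeMagma.length_mul, FreeMagma.length_mul, hm.2, hn.2]⟩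
  rw [(key m).1, (key n).1]
  exact isPowerAssociative k X _ _ (by rw [(key m).2, (key n).2, h]) _

/-- By power-associativity, monomials of equal degree in one generator coincide, so sending `t ^ n`
to the monomial of degree `n` inverts `toPoly` on its range. -/
theorem toPoly_injective : Function.Injective (toPoly (k := k) (X := X)) := by
  classical
  let r : Polynomial k →ₗ[k] FreePowerAssoc k X :=
    (Polynomial.basisMonomials k).constr k fun n =>
      if h : ∃ m : FreeMagma X, m.length = n then monomial k h.choose else 0
  have hr : r ∘ₗ ((toPoly : FreePowerAssoc k X →ₙₐ[k] Polynomial k) :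
      FreePowerAssoc k X →ₗ[k] Polynomial k) = LinearMap.id := by
    refine LinearMap.ext_on_range (v := monomial k) span_range_monomial fun m => ?_
    have hm : ∃ n : FreeMagma X, n.length = m.length := ⟨m, rfl⟩
    have h1 : r (Polynomial.monomial m.length 1) = monomial k hm.choose := by
      have := (Polynomial.basisMonomials k).constr_basis k (fun n =>
        if h : ∃ m : FreeMagma X, m.length = n then monomial k h.choose else 0) m.length
      rw [Polynomial.coe_basisMonomials, dif_pos hm] at this
      exact this
    change r (toPoly (monomial k m)) = monomial k m
    rw [toPoly_monomial, h1]
    exact monomial_eq_of_length_eq hm.choose_spec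
  exact Function.LeftInverse.injective (g := r) fun f => LinearMap.congr_fun hr f

theorem mul_comm_of_unique (f g : FreePowerAssoc k X) : f * g = g * f :=
  toPoly_injective (by rw [map_mul, map_mul, mul_comm])

/-- An element of the free algebra on one generator `x` that is invertible under substitution is
a nonzero multiple of `x`. -/
theorem eq_smul_of_subst_eq {p q : FreePowerAssoc k X}
    (h : lift (isPowerAssociative k X) (fun _ : X => p) q = of k default) :
    ∃ a : k, p = a • of k default := by
  have hcomp : ((Polynomial.aeval (R := k) (toPoly p) : Polynomial k →ₐ[k] Polynomial k) :
      Polynomial k →ₙₐ[k] Polynomial k).comp (toPoly (X := X)) =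
      toPoly.comp (lift (isPowerAssociative k X) (fun _ : X => p)) :=
    hom_ext isPowerAssociative_of_monoid fun x => by
      change Polynomial.aeval (toPoly p) (toPoly (of k x)) = toPoly (lift _ _ (of k x))
      simp
  have h1 : (toPoly q).comp (toPoly p) = Polynomial.X := by
    have := DFunLike.congr_fun hcomp q
    rw [NonUnitalAlgHom.comp_apply, NonUnitalAlgHom.comp_apply, h, toPoly_of] at this
    exact this
  have hdeg : (toPoly q).natDegree * (toPoly p).natDegree = 1 := by
    rw [← Polynomial.natDegree_comp, h1, Polynomial.natDegree_X]
  have hp : (toPoly p).natDegree ≤ 1 := (Nat.eq_one_of_mul_eq_one_left hdeg).le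
  refine ⟨(toPoly p).coeff 1, toPoly_injective ?_⟩
  rw [map_smul, toPoly_of]
  conv_lhs => rw [Polynomial.eq_X_add_C_of_natDegree_le_one hp, toPoly_coeff_zero]
  simp [Polynomial.smul_eq_C_mul]

end Unique

end FreePowerAssoc

/-! ### The words of a normalized system of bijections -/

namespace FreePACat

open FreePowerAssoc

variable {k : Type u} [Field k]

/-- The object with one generator. -/
def point (k : Type u) [Field k] : FreePACat k := ⟨{0}⟩

/-- The object with two generators. -/
def pair (k : Type u) [Field k] : FreePACat k := ⟨{0, 1}⟩

instance : Unique (point k).gens where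
  default := ⟨0, Finset.mem_singleton_self 0⟩
  uniq x := Subtype.ext (Finset.mem_singleton.1 x.2)

/-- The first generator of `F(x₀, x₁)`. -/
def gen₀ (k : Type u) [Field k] : (pair k).gens := ⟨0, Finset.mem_insert_self 0 {1}⟩

/-- The second generator of `F(x₀, x₁)`. -/
def gen₁ (k : Type u) [Field k] : (pair k).gens :=
  ⟨1, Finset.mem_insert_of_mem (Finset.mem_singleton_self 1)⟩

theorem gen₀_ne_gen₁ : gen₀ k ≠ gen₁ k := fun h => zero_ne_one (congrArg Subtype.val h)

theorem eq_gen (x : (pair k).gens) : x = gen₀ k ∨ x = gen₁ k := by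
  rcases Finset.mem_insert.1 x.2 with h | h
  · exact Or.inl (Subtype.ext h)
  · exact Or.inr (Subtype.ext (Finset.mem_singleton.1 h))

/-- The homomorphism from the free algebra on one generator that sends the generator to `f`. -/
noncomputable def atPoint {X : FreePACat k} (f : X.Alg) : (point k).Alg →ₙₐ[k] X.Alg :=
  lift (isPowerAssociative k X.gens) fun _ => f

@[simp]
theorem atPoint_of {X : FreePACat k} (f : X.Alg) (x : (point k).gens) :
    atPoint f (of k x) = f := lift_of _ _ x

/-- The homomorphism from the free algebra on two generators that sends them to `f` and `g`. -/
noncomputable def atPair {X : FreePACat k} (f g : X.Alg) : (pair k).Alg →ₙₐ[k] X.Alg :=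
  lift (isPowerAssociative k X.gens) fun x => if x = gen₀ k then f else g

@[simp]
theorem atPair_gen₀ {X : FreePACat k} (f g : X.Alg) : atPair f g (of k (gen₀ k)) = f :=
  (lift_of _ _ _).trans (if_pos rfl)

@[simp]
theorem atPair_gen₁ {X : FreePACat k} (f g : X.Alg) : atPair f g (of k (gen₁ k)) = g :=
  (lift_of _ _ _).trans (if_neg gen₀_ne_gen₁.symm)

/-- A system of bijections `s_F : F → F` that fixes the generators and such that both
`ψ ↦ s_F ψ s_D⁻¹` and `ψ ↦ s_F⁻¹ ψ s_D` preserve homomorphisms. -/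
structure IsNormalSystem (s : ∀ X : FreePACat k, X.Alg ≃ X.Alg) : Prop where
  gen : ∀ (X : FreePACat k) (x : X.gens), s X (of k x) = of k x
  map : ∀ {D F : FreePACat k} (ψ : D.Alg →ₙₐ[k] F.Alg),
    ∃ ψ' : D.Alg →ₙₐ[k] F.Alg, ∀ f, s F (ψ f) = ψ' (s D f)
  map_symm : ∀ {D F : FreePACat k} (ψ : D.Alg →ₙₐ[k] F.Alg),
    ∃ ψ' : D.Alg →ₙₐ[k] F.Alg, ∀ f, s F (ψ' f) = ψ (s D f)

namespace IsNormalSystem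

variable {s : ∀ X : FreePACat k, X.Alg ≃ X.Alg} (hs : IsNormalSystem s)

include hs

theorem symm : IsNormalSystem fun X => (s X).symm where
  gen X x := by rw [Equiv.symm_apply_eq, hs.gen]
  map {D F} ψ := by
    obtain ⟨ψ', h⟩ := hs.map_symm ψ
    exact ⟨ψ', fun f => by rw [Equiv.symm_apply_eq, h, Equiv.apply_symm_apply]⟩
  map_symm {D F} ψ := by
    obtain ⟨ψ', h⟩ := hs.map ψ
    exact ⟨ψ', fun f => by rw [Equiv.symm_apply_eq, h, Equiv.apply_symm_apply]⟩

theorem map_zero (X : FreePACat k) : s X 0 = 0 := by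
  obtain ⟨z, hz⟩ := hs.map (0 : X.Alg →ₙₐ[k] X.Alg)
  have h := hz ((s X).symm 0)
  rw [Equiv.apply_symm_apply, NonUnitalAlgHom.zero_apply] at h
  exact h.trans (_root_.map_zero z)

/-- The words for the scalars: `w_c` is a multiple of the generator, because substituting it
into `w_{c⁻¹}` gives the generator. -/
theorem exists_smul (c : k) :
    ∃ a : k, ∀ (X : FreePACat k) (f : X.Alg), s X (c • f) = a • s X f := by
  have key : ∃ a : k, s (point k) (c • of k default) = a • of k default := by
    by_cases hc : c = 0
    · exact ⟨0, by rw [hc, zero_smul, hs.map_zero]⟩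
    · obtain ⟨ψ', h⟩ := hs.map (atPoint (X := point k) (c • of k default))
      have h1 : ψ' = atPoint (s (point k) (c • of k default)) :=
        hom_ext (isPowerAssociative k _) fun x => by
          have := h (of k x)
          rw [hs.gen, atPoint_of] at this
          rw [← this, atPoint_of]
      refine eq_smul_of_subst_eq (q := s (point k) (c⁻¹ • of k default)) ?_
      change atPoint _ _ = _
      rw [← h1, ← h, map_smul, atPoint_of, smul_smul, inv_mul_cancel₀ hc, one_smul, hs.gen]
  obtain ⟨a, ha⟩ := key
  refine ⟨a, fun X f => ?_⟩
  obtain ⟨ψ', h⟩ := hs.map (atPoint f)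
  have h1 := h (of k default)
  have h2 := h (c • of k default)
  rw [hs.gen, atPoint_of] at h1
  rw [ha, map_smul (atPoint f), map_smul ψ', atPoint_of, ← h1] at h2
  exact h2

theorem exists_scalarMap : ∃ φ : k → k, Function.Bijective φ ∧
    ∀ (c : k) (X : FreePACat k) (f : X.Alg), s X (c • f) = φ c • s X f := by
  choose φ hφ using hs.exists_smul
  choose φ' hφ' using hs.symm.exists_smul
  have hx : (of k default : (point k).Alg) ≠ 0 := of_ne_zero _
  refine ⟨φ, Function.bijective_iff_has_inverse.2 ⟨φ', fun c => ?_, fun c => ?_⟩, hφ⟩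
  · have h := hφ' (φ c) (point k) (of k default)
    rw [hs.symm.gen, ← hs.gen, ← hφ, Equiv.symm_apply_apply, hs.gen] at h
    exact (smul_left_injective k hx h).symm
  · have h := hφ (φ' c) (point k) (of k default)
    rw [hs.gen, ← hs.symm.gen, ← hφ', Equiv.apply_symm_apply, hs.symm.gen] at h
    exact (smul_left_injective k hx h).symm

/-- If `v` is homogeneous of degree `d` under rescaling, so is `s v`. -/
theorem rescale_apply {X : FreePACat k} {v : X.Alg} {d : ℕ} (hv : ∀ c : k, rescale c v = c ^ d • v)
    (c : k) : rescale c (s X v) = c ^ d • s X v := by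
  obtain ⟨φ, hφ, hsφ⟩ := hs.exists_scalarMap
  obtain ⟨b, rfl⟩ := hφ.surjective c
  obtain ⟨ψ', h⟩ := hs.map (rescale (X := X.gens) b)
  have h1 : ψ' = rescale (φ b) := hom_ext (isPowerAssociative k _) fun x => by
    have := h (of k x)
    rw [hs.gen, rescale_of, hsφ, hs.gen] at this
    rw [← this, rescale_of]
  have hpow : ∀ (n : ℕ) (f : X.Alg), s X (b ^ n • f) = φ b ^ n • s X f := by
    intro n
    induction n with
    | zero => intro f; rw [pow_zero, pow_zero, one_smul, one_smul]
    | succ n ih => intro f; rw [pow_succ', pow_succ', mul_smul, mul_smul, hsφ, ih]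
  rw [← h1, ← h, hv, hpow]

/-- The value `s (v(f, g))` is obtained from the word `s v` by substituting `s f` and `s g`. -/
theorem apply_atPair {X : FreePACat k} (v : (pair k).Alg) (f g : X.Alg) :
    s X (atPair f g v) = atPair (s X f) (s X g) (s (pair k) v) := by
  obtain ⟨ψ', h⟩ := hs.map (atPair f g)
  have h1 : ψ' = atPair (s X f) (s X g) := hom_ext (isPowerAssociative k _) fun x => by
    have hx := h (of k x)
    rw [hs.gen] at hx
    rw [← hx]
    rcases eq_gen x with rfl | rfl <;> simp
  rw [h, h1]

/-- The word for the addition: it is homogeneous of degree one, and substituting zero for one of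
the generators shows that both its coefficients are one. -/
theorem map_add [CharZero k] (X : FreePACat k) (f g : X.Alg) : s X (f + g) = s X f + s X g := by
  set x : (pair k).Alg := of k (gen₀ k) with hx
  set y : (pair k).Alg := of k (gen₁ k) with hy
  have hmem := mem_span_of_rescale_eq (d := 1) (hs.rescale_apply (v := x + y) (d := 1) fun c => by
    rw [_root_.map_add, rescale_of, rescale_of, pow_one, smul_add])
  have hle : Submodule.span k (monomial k '' {m : FreeMagma (pair k).gens | m.length = 1}) ≤
      Submodule.span k {x, y} := by
    refine Submodule.span_mono ?_
    rintro _ ⟨m, hm, rfl⟩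
    obtain ⟨z, rfl⟩ := FreeMagma.length_eq_one hm
    rcases eq_gen z with rfl | rfl
    · exact Or.inl rfl
    · exact Or.inr rfl
  obtain ⟨a, b, hab⟩ := Submodule.mem_span_pair.1 (hle hmem)
  have ha : a = 1 := by
    have h := hs.apply_atPair (x + y) x 0
    rw [← hab, hs.map_zero] at h
    simp only [hx, hy, _root_.map_add, map_smul, atPair_gen₀, atPair_gen₁, add_zero, smul_zero,
      hs.gen] at h
    exact (smul_left_injective k (of_ne_zero (gen₀ k)) (by simpa using h)).symm
  have hb : b = 1 := by
    have h := hs.apply_atPair (x + y) 0 y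
    rw [← hab, hs.map_zero] at h
    simp only [hx, hy, _root_.map_add, map_smul, atPair_gen₀, atPair_gen₁, zero_add, smul_zero,
      hs.gen] at h
    exact (smul_left_injective k (of_ne_zero (gen₁ k)) (by simpa using h)).symm
  have h := hs.apply_atPair (x + y) f g
  rw [← hab, ha, hb] at h
  simpa [hx, hy] using h

/-- The word for the multiplication is homogeneous of degree two. -/
theorem exists_mul [CharZero k] : ∃ α β : k, ∀ (X : FreePACat k) (f g : X.Alg),
    s X (f * g) = α • (s X f * s X g) + β • (s X g * s X f) := by
  set x : (pair k).Alg := of k (gen₀ k) with hx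
  set y : (pair k).Alg := of k (gen₁ k) with hy
  have hmem := mem_span_of_rescale_eq (d := 2) (hs.rescale_apply (v := x * y) (d := 2) fun c => by
    rw [map_mul, rescale_of, rescale_of, smul_mul_smul_comm, pow_two])
  have hle : Submodule.span k (monomial k '' {m : FreeMagma (pair k).gens | m.length = 2}) ≤
      Submodule.span k {x * x, x * y} ⊔ Submodule.span k {y * x, y * y} := by
    rw [← Submodule.span_union]
    refine Submodule.span_mono ?_
    rintro _ ⟨m, hm, rfl⟩
    obtain ⟨z, t, rfl⟩ := FreeMagma.length_eq_two hm
    rw [monomial_mul, monomial_of, monomial_of]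
    rcases eq_gen z with rfl | rfl <;> rcases eq_gen t with rfl | rfl
    · exact Or.inl (Or.inl rfl)
    · exact Or.inl (Or.inr rfl)
    · exact Or.inr (Or.inl rfl)
    · exact Or.inr (Or.inr rfl)
  obtain ⟨p, hp, q, hq, hpq⟩ := Submodule.mem_sup.1 (hle hmem)
  obtain ⟨a, α, rfl⟩ := Submodule.mem_span_pair.1 hp
  obtain ⟨β, d, rfl⟩ := Submodule.mem_span_pair.1 hq
  -- The squares are excluded by substituting zero for one of the generators.
  have ha : a = 0 := by
    have h := hs.apply_atPair (x * y) x 0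
    rw [← hpq, hs.map_zero] at h
    simp only [hx, hy, _root_.map_add, map_smul, map_mul, atPair_gen₀, atPair_gen₁, add_zero,
      smul_zero, mul_zero, zero_mul, hs.gen, hs.map_zero] at h
    exact (smul_eq_zero.1 h.symm).resolve_right (mul_of_ne_zero _ _)
  have hd : d = 0 := by
    have h := hs.apply_atPair (x * y) 0 y
    rw [← hpq, hs.map_zero] at h
    simp only [hx, hy, _root_.map_add, map_smul, map_mul, atPair_gen₀, atPair_gen₁, zero_add,
      smul_zero, mul_zero, zero_mul, hs.gen, hs.map_zero] at h
    exact (smul_eq_zero.1 h.symm).resolve_right (mul_of_ne_zero _ _)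
  refine ⟨α, β, fun X f g => ?_⟩
  have h := hs.apply_atPair (x * y) f g
  rw [← hpq, ha, hd] at h
  simpa [hx, hy] using h

/-- A normalized system of bijections is given by words `φ(λ) x`, `x₁ + x₂` and
`α x₁ x₂ + β x₂ x₁`. -/
theorem exists_words [CharZero k] : ∃ (φ : RingAut k) (α β : k), α ≠ β ∧ α ≠ -β ∧
    ∀ X, IsTwistedHom φ α β (s X) := by
  obtain ⟨φ, hbij, hφ⟩ := hs.exists_scalarMap
  obtain ⟨α, β, hmul⟩ := hs.exists_mul
  have hx : (of k default : (point k).Alg) ≠ 0 := of_ne_zero _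
  have hφ_add : ∀ c d, φ (c + d) = φ c + φ d := fun c d => by
    have h := hφ (c + d) (point k) (of k default)
    rw [add_smul, hs.map_add, hφ, hφ, ← add_smul] at h
    rw [hs.gen] at h
    exact (smul_left_injective k hx h).symm
  have hφ_mul : ∀ c d, φ (c * d) = φ c * φ d := fun c d => by
    have h := hφ (c * d) (point k) (of k default)
    rw [mul_smul, hφ, hφ, ← mul_smul] at h
    rw [hs.gen] at h
    exact (smul_left_injective k hx h).symm
  refine ⟨{ Equiv.ofBijective φ hbij with map_mul' := hφ_mul, map_add' := hφ_add }, α, β, ?_, ?_,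
    fun X => ⟨fun c f => hφ c X f, hs.map_add X, hmul X⟩⟩
  · rintro rfl
    refine mul_of_ne_mul_of (k := k) (gen₀_ne_gen₁ (k := k)) ((s (pair k)).injective ?_)
    rw [hmul, hmul, add_comm]
  · rintro rfl
    refine mul_of_ne_zero (k := k) (gen₀ k) (gen₀ k) ((s (pair k)).injective ?_)
    rw [hmul, hs.map_zero, neg_smul, neg_add_cancel]

end IsNormalSystem

end FreePACat

/-! ### Equivalences of the category as systems of bijections -/

namespace FreePACat

open FreePowerAssoc

variable {k : Type u} [Field k]

@[simp]
theorem comp_toAlgHom_apply {X Y Z : FreePACat k} (f : X ⟶ Y) (g : Y ⟶ Z) (a : X.Alg) :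
    (f ≫ g).toAlgHom a = g.toAlgHom (f.toAlgHom a) := rfl

@[simp]
theorem id_toAlgHom_apply (X : FreePACat k) (a : X.Alg) : (𝟙 X : X ⟶ X).toAlgHom a = a := rfl

theorem hom_ext_of {X Y : FreePACat k} {f g : X ⟶ Y}
    (h : ∀ x, f.toAlgHom (of k x) = g.toAlgHom (of k x)) : f = g :=
  Hom.ext (FreePowerAssoc.hom_ext (isPowerAssociative k _) h)

/-- The morphism with given values on the generators. -/
noncomputable def desc {X Y : FreePACat k} (v : X.gens → Y.Alg) : X ⟶ Y :=
  ⟨lift (isPowerAssociative k Y.gens) v⟩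

@[simp]
theorem desc_of {X Y : FreePACat k} (v : X.gens → Y.Alg) (x : X.gens) :
    (desc v).toAlgHom (of k x) = v x := lift_of (isPowerAssociative k Y.gens) _ x

theorem iso_hom_inv_apply {X Y : FreePACat k} (e : X ≅ Y) (a : X.Alg) :
    e.inv.toAlgHom (e.hom.toAlgHom a) = a := by
  rw [← comp_toAlgHom_apply, e.hom_inv_id, id_toAlgHom_apply]

theorem iso_inv_hom_apply {X Y : FreePACat k} (e : X ≅ Y) (a : Y.Alg) :
    e.hom.toAlgHom (e.inv.toAlgHom a) = a := by
  rw [← comp_toAlgHom_apply, e.inv_hom_id, id_toAlgHom_apply]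

/-- The bijection underlying an isomorphism. -/
noncomputable def isoEquiv {X Y : FreePACat k} (e : X ≅ Y) : X.Alg ≃ Y.Alg where
  toFun := e.hom.toAlgHom
  invFun := e.inv.toAlgHom
  left_inv := iso_hom_inv_apply e
  right_inv := iso_inv_hom_apply e

/-- A bijective homomorphism is an isomorphism. -/
noncomputable def isoOfTwistedHom {X Y : FreePACat k} {s : X.Alg ≃ Y.Alg}
    (hs : IsTwistedHom (1 : RingAut k) 1 0 s) : X ≅ Y where
  hom := ⟨hs.toAlgHom⟩
  inv := ⟨hs.toAlgHom.inverse s.symm s.symm_apply_apply s.apply_symm_apply⟩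
  hom_inv_id := Hom.ext (NonUnitalAlgHom.ext s.symm_apply_apply)
  inv_hom_id := Hom.ext (NonUnitalAlgHom.ext s.apply_symm_apply)

/-! ### The image of the free algebra on one generator -/

theorem subsingleton_end_iff (X : FreePACat k) : Subsingleton (X ⟶ X) ↔ IsEmpty X.gens := by
  refine ⟨fun h => ⟨fun x => ?_⟩, fun h => ⟨fun f g => hom_ext_of fun x => h.elim x⟩⟩
  have h1 := congrArg (fun f : X ⟶ X => f.toAlgHom (of k x))
    (Subsingleton.elim (𝟙 X) (desc fun _ => 0))
  rw [desc_of] at h1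
  exact of_ne_zero x h1

theorem nonempty_gens_obj (F : FreePACat k ⥤ FreePACat k) [F.IsEquivalence] {X : FreePACat k}
    (hX : Nonempty X.gens) : Nonempty (F.obj X).gens := by
  by_contra h
  have h1 := (subsingleton_end_iff (F.obj X)).2 (not_nonempty_iff.1 h)
  have h2 : Subsingleton (X ⟶ X) := ⟨fun f g => F.map_injective (Subsingleton.elim _ _)⟩
  exact not_isEmpty_iff.2 hX ((subsingleton_end_iff X).1 h2)

/-- A retract of the free algebra on one generator is commutative, hence has at most one
generator. -/
theorem subsingleton_gens_of_retract {X P : FreePACat k} [Unique P.gens] (i : X ⟶ P) (r : P ⟶ X)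
    (h : i ≫ r = 𝟙 X) : Subsingleton X.gens := by
  refine ⟨fun x y => ?_⟩
  by_contra hxy
  have key : ∀ a : X.Alg, r.toAlgHom (i.toAlgHom a) = a := fun a => by
    rw [← comp_toAlgHom_apply, h, id_toAlgHom_apply]
  refine mul_of_ne_mul_of (k := k) hxy ?_
  rw [← key (of k x * of k y), ← key (of k y * of k x), map_mul i.toAlgHom, map_mul i.toAlgHom,
    mul_comm_of_unique]

/-- Every equivalence preserves the free algebra on one generator: this algebra is a retract of
every nonzero object, and every nonzero retract of it is isomorphic to it. -/
theorem nonempty_iso_point (F : FreePACat k ⥤ FreePACat k) [F.IsEquivalence] :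
    Nonempty (point k ≅ F.obj (point k)) := by
  obtain ⟨q⟩ := nonempty_gens_obj F.inv (X := point k) ⟨default⟩
  let i : point k ⟶ F.inv.obj (point k) := desc fun _ => of k q
  let r : F.inv.obj (point k) ⟶ point k := desc fun _ => of k default
  have hir : i ≫ r = 𝟙 _ := hom_ext_of fun x => by
    rw [comp_toAlgHom_apply, desc_of, desc_of, id_toAlgHom_apply, Unique.eq_default x]
  let e : F.obj (F.inv.obj (point k)) ≅ point k := F.asEquivalence.counitIso.app (point k)
  have hsub : Subsingleton (F.obj (point k)).gens :=
    subsingleton_gens_of_retract (F.map i ≫ e.hom) (e.inv ≫ F.map r) (by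
      rw [Category.assoc, e.hom_inv_id_assoc, ← F.map_comp, hir, F.map_id])
  obtain ⟨y⟩ := nonempty_gens_obj F (X := point k) ⟨default⟩
  exact ⟨desc fun _ => of k y, desc fun _ => of k default,
    hom_ext_of fun x => by
      rw [comp_toAlgHom_apply, desc_of, desc_of, id_toAlgHom_apply, Unique.eq_default x],
    hom_ext_of fun x => by
      rw [comp_toAlgHom_apply, desc_of, desc_of, id_toAlgHom_apply, Subsingleton.elim x y]⟩

/-! ### Natural systems of bijections -/

/-- A system of bijections `σ_X : X → F(X)` that is natural on the underlying sets. -/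
def IsNaturalSystem (F : FreePACat k ⥤ FreePACat k) (σ : ∀ X, X.Alg ≃ (F.obj X).Alg) : Prop :=
  ∀ {X Y : FreePACat k} (ψ : X ⟶ Y) (f : X.Alg),
    σ Y (ψ.toAlgHom f) = (F.map ψ).toAlgHom (σ X f)

/-- The free algebra on one generator represents the underlying set. -/
noncomputable def pointEquiv (X : FreePACat k) : X.Alg ≃ (point k ⟶ X) where
  toFun f := ⟨atPoint f⟩
  invFun ψ := ψ.toAlgHom (of k default)
  left_inv f := atPoint_of f _
  right_inv ψ := hom_ext_of fun x => by rw [Unique.eq_default x]; exact atPoint_of _ _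

/-- Since `F` fixes the free algebra on one generator up to isomorphism, and this algebra
represents the underlying set, `F` commutes with the underlying-set functor. -/
theorem exists_isNaturalSystem (F : FreePACat k ⥤ FreePACat k) [F.IsEquivalence] :
    ∃ σ : ∀ X, X.Alg ≃ (F.obj X).Alg, IsNaturalSystem F σ := by
  obtain ⟨e⟩ := nonempty_iso_point F
  refine ⟨fun X => (pointEquiv X).trans ((Functor.FullyFaithful.ofFullyFaithful F).homEquiv.trans
    ((e.symm.homCongr (Iso.refl _)).trans (pointEquiv (F.obj X)).symm)), fun {X Y} ψ f => ?_⟩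
  have h : pointEquiv Y (ψ.toAlgHom f) = pointEquiv X f ≫ ψ := hom_ext_of fun x => by
    rw [comp_toAlgHom_apply]
    change atPoint _ _ = ψ.toAlgHom (atPoint _ _)
    rw [atPoint_of, atPoint_of]
  have hF : ∀ {Z : FreePACat k} (g : point k ⟶ Z),
      (e.symm.homCongr (Iso.refl (F.obj Z))) (F.map g) = e.hom ≫ F.map g := fun g => by simp
  change (e.symm.homCongr (Iso.refl (F.obj Y)) (F.map (pointEquiv Y (ψ.toAlgHom f)))).toAlgHom
    (of k default) = (F.map ψ).toAlgHom
      ((e.symm.homCongr (Iso.refl (F.obj X)) (F.map (pointEquiv X f))).toAlgHom (of k default))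
  rw [hF, hF, h, F.map_comp, ← Category.assoc, comp_toAlgHom_apply]

section Natural

variable {F : FreePACat k ⥤ FreePACat k} {σ : ∀ X, X.Alg ≃ (F.obj X).Alg}
  (hσ : IsNaturalSystem F σ)

include hσ

/-- Any two natural systems differ by a scalar: their quotient is given by an element of the free
algebra on one generator that is invertible under substitution. -/
theorem IsNaturalSystem.exists_smul_eq {σ' : ∀ X, X.Alg ≃ (F.obj X).Alg}
    (hσ' : IsNaturalSystem F σ') : ∃ a : k, ∀ X (f : X.Alg), σ' X f = σ X (a • f) := by
  have hz : ∀ {X Y : FreePACat k} (ψ : X ⟶ Y) (f : X.Alg),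
      (σ Y).symm (σ' Y (ψ.toAlgHom f)) = ψ.toAlgHom ((σ X).symm (σ' X f)) := fun ψ f => by
    rw [Equiv.symm_apply_eq, hσ, hσ', Equiv.apply_symm_apply]
  have hz' : ∀ {X Y : FreePACat k} (ψ : X ⟶ Y) (f : X.Alg),
      (σ' Y).symm (σ Y (ψ.toAlgHom f)) = ψ.toAlgHom ((σ' X).symm (σ X f)) := fun ψ f => by
    rw [Equiv.symm_apply_eq, hσ, hσ', Equiv.apply_symm_apply]
  obtain ⟨a, ha⟩ := eq_smul_of_subst_eq (p := (σ (point k)).symm (σ' (point k) (of k default)))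
    (q := (σ' (point k)).symm (σ (point k) (of k default))) (by
      change (Hom.mk (atPoint _) : point k ⟶ point k).toAlgHom _ = _
      rw [← hz', Equiv.symm_apply_eq, ← Equiv.eq_symm_apply]
      exact atPoint_of _ _)
  refine ⟨a, fun X f => ?_⟩
  have h := hz (⟨atPoint f⟩ : point k ⟶ X) (of k default)
  rw [ha] at h
  rw [← Equiv.symm_apply_eq]
  have h1 : (⟨atPoint f⟩ : point k ⟶ X).toAlgHom (of k default) = f := atPoint_of f _
  rwa [map_smul, h1] at h

variable [F.IsEquivalence]

/-- The images of the generators of `X` form a free basis of `F(X)`. -/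
theorem IsNaturalSystem.exists_iso (X : FreePACat k) :
    ∃ τ : X ≅ F.obj X, ∀ x, τ.hom.toAlgHom (of k x) = σ X (of k x) := by
  have huniq : ∀ {Z : FreePACat k} (g h : F.obj X ⟶ F.obj Z),
      (∀ x, g.toAlgHom (σ X (of k x)) = h.toAlgHom (σ X (of k x))) → g = h := by
    intro Z g h H
    obtain ⟨g, rfl⟩ := F.map_surjective g
    obtain ⟨h, rfl⟩ := F.map_surjective h
    congr 1
    refine hom_ext_of fun x => (σ Z).injective ?_
    rw [hσ, hσ, H]
  let e : F.obj (F.objPreimage X) ≅ X := F.objObjPreimageIso X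
  let g : F.obj X ⟶ X := F.map (desc fun x => (σ (F.objPreimage X)).symm
    (e.inv.toAlgHom (of k x))) ≫ e.hom
  have hg : ∀ x, g.toAlgHom (σ X (of k x)) = of k x := fun x => by
    rw [comp_toAlgHom_apply, ← hσ, desc_of, Equiv.apply_symm_apply, iso_inv_hom_apply]
  exact ⟨⟨desc fun x => σ X (of k x), g,
    hom_ext_of fun x => by rw [comp_toAlgHom_apply, desc_of, hg, id_toAlgHom_apply],
    huniq _ _ fun x => by rw [comp_toAlgHom_apply, hg, desc_of, id_toAlgHom_apply]⟩,
    fun x => desc_of _ x⟩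

/-- Composing `σ_X` with the inverse of the isomorphism `X ≅ F(X)` that agrees with it on the
generators gives a normalized system. -/
theorem IsNaturalSystem.exists_words [CharZero k] : ∃ (φ : RingAut k) (α β : k),
    α ≠ β ∧ α ≠ -β ∧ ∀ X, IsTwistedHom φ α β (σ X) := by
  choose τ hτ using hσ.exists_iso
  have hs : IsNormalSystem fun X => (σ X).trans (isoEquiv (τ X)).symm := by
    refine ⟨fun X x => ?_, fun {D E} ψ => ?_, fun {D E} ψ => ?_⟩
    · change (τ X).inv.toAlgHom (σ X (of k x)) = _
      rw [← hτ, iso_hom_inv_apply]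
    · refine ⟨((τ D).hom ≫ F.map ⟨ψ⟩ ≫ (τ E).inv).toAlgHom, fun f => ?_⟩
      change (τ E).inv.toAlgHom (σ E ((⟨ψ⟩ : D ⟶ E).toAlgHom f)) =
        ((τ D).hom ≫ F.map ⟨ψ⟩ ≫ (τ E).inv).toAlgHom ((τ D).inv.toAlgHom (σ D f))
      rw [comp_toAlgHom_apply, comp_toAlgHom_apply, iso_inv_hom_apply, hσ]
    · refine ⟨(F.preimage ((τ D).inv ≫ (⟨ψ⟩ : D ⟶ E) ≫ (τ E).hom)).toAlgHom, fun f => ?_⟩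
      change (τ E).inv.toAlgHom (σ E _) = (⟨ψ⟩ : D ⟶ E).toAlgHom ((τ D).inv.toAlgHom (σ D f))
      rw [hσ, F.map_preimage, comp_toAlgHom_apply, comp_toAlgHom_apply, iso_hom_inv_apply]
  obtain ⟨φ, α, β, h, h', hw⟩ := hs.exists_words
  refine ⟨φ, α, β, h, h', fun X => ?_⟩
  convert! (hw X).algHom_comp (τ X).hom.toAlgHom using 1
  funext f
  exact (iso_inv_hom_apply (τ X) (σ X f)).symm

/-- The automorphism `φ` and the ratio `α : β` depend only on the functor. -/
theorem IsNaturalSystem.words_unique {σ' : ∀ X, X.Alg ≃ (F.obj X).Alg}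
    (hσ' : IsNaturalSystem F σ') {φ φ' : RingAut k} {α β α' β' : k}
    (h : ∀ X, IsTwistedHom φ α β (σ X)) (h' : ∀ X, IsTwistedHom φ' α' β' (σ' X)) :
    φ = φ' ∧ ∃ b : k, b ≠ 0 ∧ α = b * α' ∧ β = b * β' := by
  obtain ⟨a, ha⟩ := hσ.exists_smul_eq hσ'
  set x : (pair k).Alg := of k (gen₀ k) with hx
  set y : (pair k).Alg := of k (gen₁ k) with hy
  have hb : ∀ X (f : X.Alg), σ' X f = φ a • σ X f := fun X f => by rw [ha, (h X).smul]
  have hσx : σ' (pair k) x ≠ 0 := by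
    rw [← (h' (pair k)).map_zero]
    exact fun h0 => of_ne_zero (gen₀ k) ((σ' (pair k)).injective h0)
  have hb0 : φ a ≠ 0 := by
    intro h0
    rw [hb, h0, zero_smul] at hσx
    exact hσx rfl
  refine ⟨?_, φ a, hb0, ?_⟩
  · ext c
    refine smul_left_injective k hσx ?_
    change φ c • σ' _ x = φ' c • σ' _ x
    rw [← (h' (pair k)).smul, hb, hb, (h (pair k)).smul, smul_comm]
  · obtain ⟨τ, hτ⟩ := hσ.exists_iso (pair k)
    have h1 := hb (pair k) (x * y)
    rw [(h' (pair k)).mul, hb, hb, (h (pair k)).mul, hx, hy, ← hτ, ← hτ] at h1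
    have h2 := congrArg τ.inv.toAlgHom h1
    simp only [map_add, map_smul, map_mul, iso_hom_inv_apply, smul_mul_smul_comm, smul_add,
      smul_smul] at h2
    obtain ⟨h3, h4⟩ := eq_of_mul_of_comb_eq gen₀_ne_gen₁ h2
    constructor
    · exact mul_left_cancel₀ hb0 (by rw [← h3]; ring)
    · exact mul_left_cancel₀ hb0 (by rw [← h4]; ring)

end Natural

/-! ### The functor given by a normalized system of bijections -/

namespace IsNormalSystem

variable {s : ∀ X : FreePACat k, X.Alg ≃ X.Alg}

/-- The functor that is the identity on objects and `ψ ↦ s_F ψ s_D⁻¹` on morphisms. -/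
noncomputable def functor (hs : IsNormalSystem s) : FreePACat k ⥤ FreePACat k where
  obj X := X
  map ψ := ⟨(hs.map ψ.toAlgHom).choose⟩
  map_id X := Hom.ext <| NonUnitalAlgHom.ext fun f => by
    have h := (hs.map (𝟙 X : X ⟶ X).toAlgHom).choose_spec ((s X).symm f)
    rw [id_toAlgHom_apply, Equiv.apply_symm_apply] at h
    exact h.symm
  map_comp {X Y Z} ψ χ := Hom.ext <| NonUnitalAlgHom.ext fun f => by
    have h := (hs.map (ψ ≫ χ).toAlgHom).choose_spec ((s X).symm f)
    have h1 := (hs.map ψ.toAlgHom).choose_spec ((s X).symm f)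
    have h2 := (hs.map χ.toAlgHom).choose_spec (ψ.toAlgHom ((s X).symm f))
    rw [Equiv.apply_symm_apply] at h h1
    rw [h1] at h2
    exact h.symm.trans h2

theorem functor_map_apply (hs : IsNormalSystem s) {X Y : FreePACat k} (ψ : X ⟶ Y) (f : X.Alg) :
    (hs.functor.map ψ).toAlgHom f = s Y (ψ.toAlgHom ((s X).symm f)) := by
  have h := (hs.map ψ.toAlgHom).choose_spec ((s X).symm f)
  rw [Equiv.apply_symm_apply] at h
  exact h.symm

theorem functor_comp_symm (hs : IsNormalSystem s) : hs.functor ⋙ hs.symm.functor = 𝟭 _ := by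
  have key : ∀ {X Y : FreePACat k} (ψ : X ⟶ Y), hs.symm.functor.map (hs.functor.map ψ) = ψ := by
    intro X Y ψ
    refine Hom.ext <| NonUnitalAlgHom.ext fun f => ?_
    refine (hs.symm.functor_map_apply (hs.functor.map ψ) f).trans ?_
    refine (congrArg (s Y).symm (hs.functor_map_apply ψ _)).trans ?_
    exact (Equiv.symm_apply_apply (s Y) _).trans
      (congrArg ψ.toAlgHom (Equiv.symm_apply_apply (s X) f))
  refine CategoryTheory.Functor.ext (fun X => rfl) fun X Y ψ => (key ψ).trans ?_
  exact ((Category.id_comp _).trans (Category.comp_id ψ)).symm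

/-- The automorphism of the category given by a normalized system of bijections. -/
noncomputable def aut (hs : IsNormalSystem s) : AutPACat k where
  hom := hs.functor.toCatHom
  inv := hs.symm.functor.toCatHom
  hom_inv_id := congrArg Functor.toCatHom hs.functor_comp_symm
  inv_hom_id := congrArg Functor.toCatHom hs.symm.functor_comp_symm

end IsNormalSystem

/-- The twisted endomorphisms that fix the generators form a normalized system. -/
theorem exists_isNormalSystem (φ : RingAut k) {α β : k} (h : α ≠ β) (h' : α ≠ -β) :
    ∃ s : ∀ X : FreePACat k, X.Alg ≃ X.Alg, IsNormalSystem s ∧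
      ∀ X, IsTwistedHom φ α β (s X) := by
  choose s hs hs1 using fun X : FreePACat k => exists_twistedEquiv X.gens φ h h'
  refine ⟨s, ⟨hs1, fun {D F} ψ => ?_, fun {D F} ψ => ?_⟩, hs⟩
  · refine ⟨(((hs F).comp_algHom ψ).comp_inverse h h' ((hs D).symm h h')).toAlgHom, fun f => ?_⟩
    change _ = s F (ψ ((s D).symm (s D f)))
    rw [Equiv.symm_apply_apply]
  · refine ⟨((hs D).algHom_comp ψ |>.inverse_comp h h' ((hs F).symm h h')).toAlgHom, fun f => ?_⟩
    exact (s F).apply_symm_apply _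

end FreePACat

namespace AutPACat

open FreePowerAssoc FreePACat

variable {k : Type u} [Field k]

/-! ### Strongly stable automorphisms and words -/

instance (Φ : AutPACat k) : (functor Φ).IsEquivalence :=
  (Cat.equivOfIso Φ).isEquivalence_functor

theorem ext_of_functor_eq {Φ Ψ : AutPACat k} (h : functor Φ = functor Ψ) : Φ = Ψ :=
  Iso.ext (Cat.Hom.ext h)

theorem eq_of_eqToHom_conj_eq {C : Type*} [Category C] {X X' Y Y' : C} (hX : X = X') (hY : Y = Y')
    {f : X ⟶ Y} {g : X' ⟶ Y'} (h : eqToHom hX.symm ≫ f ≫ eqToHom hY = g) :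
    f = eqToHom hX ≫ g ≫ eqToHom hY.symm := by
  rw [← h]
  simp

namespace IsBijectionSystem

variable {Φ : AutPACat k} {s : ∀ X : FreePACat k, X.Alg ≃ X.Alg}

theorem isNormalSystem (h : Φ.IsBijectionSystem s) : IsNormalSystem s := by
  refine ⟨h.gen_eq, fun {D F} ψ => ?_, fun {D F} ψ => ?_⟩
  · refine ⟨(eqToHom (h.obj_eq D).symm ≫ (functor Φ).map (⟨ψ⟩ : D ⟶ F) ≫
      eqToHom (h.obj_eq F)).toAlgHom, fun f => ?_⟩
    rw [h.map_eq, Equiv.symm_apply_apply]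
  · let χ : D ⟶ F := (functor Φ).preimage
      (eqToHom (h.obj_eq D) ≫ (⟨ψ⟩ : D ⟶ F) ≫ eqToHom (h.obj_eq F).symm)
    refine ⟨χ.toAlgHom, fun f => ?_⟩
    have h1 := h.map_eq χ (s D f)
    rw [Functor.map_preimage, Equiv.symm_apply_apply] at h1
    rw [← h1]
    simp

/-- The bijections are determined by `Φ`, because `s_X f` is the image of the generator under
`Φ(x ↦ f)`. -/
theorem unique {s' : ∀ X : FreePACat k, X.Alg ≃ X.Alg} (h : Φ.IsBijectionSystem s)
    (h' : Φ.IsBijectionSystem s') : s = s' := by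
  funext X
  ext f
  have key : ∀ {t : ∀ X : FreePACat k, X.Alg ≃ X.Alg} (ht : Φ.IsBijectionSystem t),
      t X f = (eqToHom (ht.obj_eq (point k)).symm ≫ (functor Φ).map (⟨atPoint f⟩ : point k ⟶ X) ≫
        eqToHom (ht.obj_eq X)).toAlgHom (of k default) := fun {t} ht => by
    rw [ht.map_eq, ← ht.gen_eq, Equiv.symm_apply_apply]
    exact congrArg (t X) (atPoint_of f _).symm
  rw [key h, key h']

theorem functor_eq (h : Φ.IsBijectionSystem s) : functor Φ = h.isNormalSystem.functor := by
  refine CategoryTheory.Functor.ext h.obj_eq fun X Y ψ => ?_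
  exact eq_of_eqToHom_conj_eq (h.obj_eq X) (h.obj_eq Y) <|
    Hom.ext <| NonUnitalAlgHom.ext fun f =>
      (h.map_eq ψ f).trans (h.isNormalSystem.functor_map_apply ψ f).symm

end IsBijectionSystem

theorem _root_.FreePACat.IsNormalSystem.isBijectionSystem
    {s : ∀ X : FreePACat k, X.Alg ≃ X.Alg} (hs : IsNormalSystem s) :
    hs.aut.IsBijectionSystem s where
  obj_eq _ := rfl
  map_eq ψ f := hs.functor_map_apply ψ f
  gen_eq := hs.gen

theorem existsUnique_words [CharZero k] {Φ : AutPACat k} (h : Φ.IsStronglyStable) :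
    ∃! p : RingAut k × k × k,
      p.2.1 ≠ p.2.2 ∧ p.2.1 ≠ -p.2.2 ∧ Φ.IsGivenByWords p.1 p.2.1 p.2.2 := by
  obtain ⟨s, hs⟩ := h
  obtain ⟨φ, α, β, h, h', hw⟩ := hs.isNormalSystem.exists_words
  refine ⟨(φ, α, β), ⟨h, h', s, hs, fun X => ⟨(hw X).smul, (hw X).add, (hw X).mul⟩⟩, ?_⟩
  rintro ⟨φ', α', β'⟩ ⟨-, -, s', hs', hw'⟩
  obtain rfl := hs.unique hs'
  have hφ : φ' = φ := by
    ext c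
    have h1 := (hw' (point k)).1 c (of k default)
    rw [(hw (point k)).smul, hs.gen_eq] at h1
    exact (smul_left_injective k (of_ne_zero (default : (point k).gens)) h1).symm
  have hm := (hw' (pair k)).2.2 (of k (gen₀ k)) (of k (gen₁ k))
  rw [(hw (pair k)).mul, hs.gen_eq, hs.gen_eq] at hm
  obtain ⟨hα, hβ⟩ := eq_of_mul_of_comb_eq gen₀_ne_gen₁ hm
  rw [hφ, hα, hβ]

theorem existsUnique_of_words (φ : RingAut k) {α β : k} (h : α ≠ β) (h' : α ≠ -β) :
    ∃! Φ : AutPACat k, Φ.IsGivenByWords φ α β := by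
  obtain ⟨s, hs, hw⟩ := exists_isNormalSystem φ h h'
  refine ⟨hs.aut, ⟨s, hs.isBijectionSystem, fun X => ⟨(hw X).smul, (hw X).add, (hw X).mul⟩⟩, ?_⟩
  rintro Ψ ⟨t, ht, htw⟩
  have hts : t = s := by
    funext X
    refine DFunLike.coe_injective (twistedHom_ext (isPowerAssociative k _)
      (⟨(htw X).1, (htw X).2.1, (htw X).2.2⟩ : IsTwistedHom φ α β (t X)) (hw X) fun x => ?_)
    rw [ht.gen_eq, hs.gen]
  subst hts
  exact ext_of_functor_eq ht.functor_eq

/-! ### The outer automorphism group -/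

/-- There are natural bijections `σ_X : X → Φ(X)` that carry the operations of `X` to those given
by the words `φ(λ) x`, `x₁ + x₂` and `α x₁ x₂ + β x₂ x₁`, where `α ≠ ± β`. Unlike for
`IsGivenByWords`, `Φ` may move the objects and `σ_X` need not fix generators. -/
def HasWords (Φ : AutPACat k) (φ : RingAut k) (α β : k) : Prop :=
  α ≠ β ∧ α ≠ -β ∧ ∃ σ : ∀ X, X.Alg ≃ ((functor Φ).obj X).Alg,
    IsNaturalSystem (functor Φ) σ ∧ ∀ X, IsTwistedHom φ α β (σ X)

theorem exists_hasWords [CharZero k] (Φ : AutPACat k) : ∃ φ α β, Φ.HasWords φ α β := by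
  obtain ⟨σ, hσ⟩ := exists_isNaturalSystem (functor Φ)
  obtain ⟨φ, α, β, h, h', hw⟩ := hσ.exists_words
  exact ⟨φ, α, β, h, h', σ, hσ, hw⟩

theorem HasWords.mul {Φ Ψ : AutPACat k} {φ ψ : RingAut k} {α β γ δ : k} (h : Φ.HasWords φ α β)
    (h' : Ψ.HasWords ψ γ δ) :
    (Φ * Ψ).HasWords (φ * ψ) (φ γ * α + φ δ * β) (φ γ * β + φ δ * α) := by
  obtain ⟨h1, h2, σ, hσ, hw⟩ := h
  obtain ⟨h1', h2', τ, hτ, hw'⟩ := h'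
  refine ⟨fun h0 => ?_, fun h0 => ?_, fun X => (τ X).trans (σ ((functor Ψ).obj X)),
    fun {X Y} χ f => ?_, fun X => (hw _).comp (hw' X)⟩
  · have : (φ γ - φ δ) * (α - β) = 0 := by linear_combination h0
    rcases mul_eq_zero.1 this with h3 | h3
    · exact h1' (φ.injective (sub_eq_zero.1 h3))
    · exact h1 (sub_eq_zero.1 h3)
  · have : (φ γ + φ δ) * (α + β) = 0 := by linear_combination h0
    rcases mul_eq_zero.1 this with h3 | h3
    · exact h2' (φ.injective (by rw [map_neg]; exact eq_neg_of_add_eq_zero_left h3))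
    · exact h2 (eq_neg_of_add_eq_zero_left h3)
  · change σ _ (τ Y _) = ((functor Φ).map ((functor Ψ).map χ)).toAlgHom (σ _ (τ X f))
    rw [hτ, hσ]

theorem exists_of_hasWords (φ : RingAut k) {α β : k} (h : α ≠ β) (h' : α ≠ -β) :
    ∃ Φ : AutPACat k, Φ.HasWords φ α β := by
  obtain ⟨s, hs, hw⟩ := exists_isNormalSystem φ h h'
  refine ⟨hs.aut, h, h', s, fun {X Y} ψ f => ?_, hw⟩
  change s Y _ = (hs.functor.map ψ).toAlgHom (s X f)
  rw [hs.functor_map_apply, Equiv.symm_apply_apply]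

theorem IsInner.hasWords {Φ : AutPACat k} (h : Φ.IsInner) : Φ.HasWords 1 1 0 := by
  obtain ⟨e⟩ := h
  refine ⟨one_ne_zero, by simp, fun X => isoEquiv (e.app X), fun {X Y} ψ f => ?_,
    fun X => IsTwistedHom.of_algHom _⟩
  exact congrArg (fun g : X ⟶ (functor Φ).obj Y => g.toAlgHom f) (e.hom.naturality ψ)

/-- Dividing the multiplication by `α` turns a natural system of bijections with words `λ x`,
`x₁ + x₂`, `α x₁ x₂` into a natural system of isomorphisms. -/
theorem HasWords.isInner {Φ : AutPACat k} {α : k} (h : Φ.HasWords 1 α 0) : Φ.IsInner := by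
  obtain ⟨h0, -, σ, hσ, hw⟩ := h
  let c : ∀ X, X.Alg ≃ ((functor Φ).obj X).Alg := fun X =>
    (σ X).trans (MulAction.toPerm (Units.mk0 α h0))
  have hc : ∀ X, IsTwistedHom (1 : RingAut k) 1 0 (c X) := fun X => by
    have := (hw X).smul_left h0
    rwa [inv_mul_cancel₀ h0, mul_zero] at this
  refine ⟨NatIso.ofComponents (fun X => isoOfTwistedHom (hc X)) fun {X Y} ψ =>
    Hom.ext <| NonUnitalAlgHom.ext fun f => ?_⟩
  change α • σ Y (ψ.toAlgHom f) = ((functor Φ).map ψ).toAlgHom (α • σ X f)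
  rw [map_smul, hσ]

/-- The class of `Φ` in `kˣ ⋊ Aut k`: if `Φ` is given by the words with `φ`, `α`, `β`, it is
`((α + β) / (α - β), φ)`. -/
def HasClass (Φ : AutPACat k) (p : kˣ ⋊[fieldAutAction k] RingAut k) : Prop :=
  ∃ α β, Φ.HasWords p.right α β ∧ (p.left : k) * (α - β) = α + β

theorem exists_hasClass [CharZero k] (Φ : AutPACat k) : ∃ p, Φ.HasClass p := by
  obtain ⟨φ, α, β, h⟩ := Φ.exists_hasWords
  have h1 : α - β ≠ 0 := sub_ne_zero.2 h.1
  have h2 : α + β ≠ 0 := fun h0 => h.2.1 (eq_neg_of_add_eq_zero_left h0)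
  exact ⟨⟨Units.mk0 ((α + β) / (α - β)) (div_ne_zero h2 h1), φ⟩, α, β, h,
    div_mul_cancel₀ _ h1⟩

theorem HasClass.unique {Φ : AutPACat k} {p q : kˣ ⋊[fieldAutAction k] RingAut k}
    (hp : Φ.HasClass p) (hq : Φ.HasClass q) : p = q := by
  obtain ⟨α, β, ⟨h1, -, σ, hσ, hw⟩, hl⟩ := hp
  obtain ⟨γ, δ, ⟨h1', -, τ, hτ, hw'⟩, hl'⟩ := hq
  obtain ⟨hφ, b, hb, rfl, rfl⟩ := hσ.words_unique hτ hw hw'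
  refine SemidirectProduct.ext (Units.ext ?_) hφ
  refine mul_right_cancel₀ (mul_ne_zero hb (sub_ne_zero.2 h1')) ?_
  linear_combination hl - b * hl'

/-- The words compose so that `α ± β` becomes `(α ± β) φ(γ ± δ)`: the quotients multiply as in the
semidirect product. -/
theorem HasClass.mul {Φ Ψ : AutPACat k} {p q : kˣ ⋊[fieldAutAction k] RingAut k}
    (hp : Φ.HasClass p) (hq : Ψ.HasClass q) : (Φ * Ψ).HasClass (p * q) := by
  obtain ⟨α, β, h, hl⟩ := hp
  obtain ⟨γ, δ, h', hl'⟩ := hq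
  refine ⟨_, _, h.mul h', ?_⟩
  change (p.left : k) * p.right (q.left : k) * _ = _
  have hl'' : p.right (q.left : k) * (p.right γ - p.right δ) = p.right γ + p.right δ := by
    rw [← map_sub, ← map_mul, hl', map_add]
  linear_combination p.right (q.left : k) * (p.right γ - p.right δ) * hl + (α + β) * hl''

/-- The homomorphism that maps an automorphism to its class. -/
noncomputable def outerClass (k : Type u) [Field k] [CharZero k] :
    AutPACat k →* kˣ ⋊[fieldAutAction k] RingAut k :=
  MonoidHom.mk' (fun Φ => Φ.exists_hasClass.choose) fun Φ Ψ =>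
    (Φ * Ψ).exists_hasClass.choose_spec.unique
      (Φ.exists_hasClass.choose_spec.mul Ψ.exists_hasClass.choose_spec)

theorem outerClass_eq_iff [CharZero k] {Φ : AutPACat k}
    {p : kˣ ⋊[fieldAutAction k] RingAut k} : outerClass k Φ = p ↔ Φ.HasClass p :=
  ⟨fun h => h ▸ Φ.exists_hasClass.choose_spec, fun h => Φ.exists_hasClass.choose_spec.unique h⟩

theorem outerClass_surjective [CharZero k] : Function.Surjective (outerClass k) := by
  intro p
  have h2 : (2 : k) ≠ 0 := two_ne_zero
  obtain ⟨Φ, hΦ⟩ := exists_of_hasWords (k := k) p.right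
    (α := ((p.left : k) + 1) / 2) (β := ((p.left : k) - 1) / 2)
    (fun h => h2 (by field_simp at h; linear_combination h))
    (fun h => p.left.ne_zero (by field_simp at h; linear_combination h / 2))
  exact ⟨Φ, outerClass_eq_iff.2 ⟨_, _, hΦ, by field_simp; ring⟩⟩

theorem ker_outerClass [CharZero k] : (outerClass k).ker = innerPACat k := by
  ext Φ
  rw [MonoidHom.mem_ker, outerClass_eq_iff]
  constructor
  · rintro ⟨α, β, h, hl⟩
    have hβ : β = 0 := by
      have h1 : (1 : k) * (α - β) = α + β := hl
      have h2 : (2 : k) * β = 0 := by linear_combination -h1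
      exact (mul_eq_zero.1 h2).resolve_left two_ne_zero
    subst hβ
    exact h.isInner
  · intro h
    refine ⟨1, 0, IsInner.hasWords h, ?_⟩
    change (1 : k) * _ = _
    ring

end AutPACat

theorem theorem1 (k : Type u) [Field k] [CharZero k] :
    Nonempty ((AutPACat k ⧸ innerPACat k) ≃* (kˣ ⋊[fieldAutAction k] RingAut k)) ∧
    (∀ Φ : AutPACat k, Φ.IsStronglyStable →
      ∃! p : RingAut k × k × k,
        p.2.1 ≠ p.2.2 ∧ p.2.1 ≠ -p.2.2 ∧ Φ.IsGivenByWords p.1 p.2.1 p.2.2) ∧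
    (∀ (φ : RingAut k) (α β : k), α ≠ β → α ≠ -β →
      ∃! Φ : AutPACat k, Φ.IsGivenByWords φ α β) :=
  ⟨⟨(QuotientGroup.quotientMulEquivOfEq AutPACat.ker_outerClass.symm).trans
      (QuotientGroup.quotientKerEquivOfSurjective _ AutPACat.outerClass_surjective)⟩,
    fun _ h => AutPACat.existsUnique_words h,
    fun φ _ _ h h' => AutPACat.existsUnique_of_words φ h h'⟩
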